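/- A \emph{hyperfield} is a set $H$ with a commutative multiplication and a commutative hyperaddition $+ : H\times H\to\mathcal P(H)\setminus\{\emptyset\}$ such that: $(a+b)+c=a+(b+c)$ for all $a,b,c$ (where $A+x=\bigcup_{a\in A}(a+x)$ and $x+A=\bigcup_{a\in A}(x+a)$); there is a unique $0\in H$ with $0+h=\{h\}$ for all $h$; for each $x$ there is a unique $-x$ with $0\in x+(-x)$; $x\in y+z$ implies $z\in x+(-y)$; $(H,\cdot)$ is a monoid with $x\cdot 0=0$ for all $x$; $a(b+c)=ab+ac$; and $H\setminus\{0\}$ is a group under multiplication. An isomorphism of hyperfields is a bijection $f$ with $f(ab)=f(a)f(b)$ and $f(a+b)=f(a)+f(b)$ for all $a,b$, where $f(a+b)$ is the image of the set $a+b$. For a field $F$ and a subgroup $G\le F^\times$, the set $F/G$ of $G$-orbits in $F$ is a hyperfield with $[a][b]=[ab]$ and $[a]+[b]=\{[c] : c=ag_1+bg_2,\ g_1,g_2\in G\}$; a \emph{quotient hyperfield} is a hyperfield isomorphic to some $F/G$. \textbf{Theorem.} Let $H_r$ be the number of isomorphism classes of hyperfields with $r+1$ elements, and let $Q_r$ be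 the number of those classes that consist of quotient hyperfields. For every odd positive integer $r$, $H_r$ is finite and positive, and $$\lim_{\substack{r\to\infty\\ r\ \mathrm{odd}}}\frac{Q_r}{H_r}=0 .$$ -/

import Mathlib

universe u

open Filter Topology

/-- A (commutative) hyperfield: a commutative monoid with zero in which the nonzero elements form
a group, together with a commutative, associative, nonempty-set-valued addition `hadd` that has
`0` as neutral element, unique negatives and reversibility, and over which multiplication
distributes. Uniqueness of the neutral element follows from `zero_hadd` and `hadd_comm`. -/
class Hyperfield (H : Type*) extends CommMonoidWithZero H where
  hadd : H → H → Set H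
  hadd_nonempty : ∀ a b, (hadd a b).Nonempty
  hadd_comm : ∀ a b, hadd a b = hadd b a
  hadd_assoc : ∀ a b c, (⋃ x ∈ hadd a b, hadd x c) = ⋃ x ∈ hadd b c, hadd a x
  zero_hadd : ∀ a, hadd 0 a = {a}
  existsUnique_neg : ∀ x, ∃! y, (0 : H) ∈ hadd x y
  /-- If `x ∈ y + z`, then `z ∈ x + (-y)`; here `w` is the negative of `y`. -/
  reversible : ∀ x y z w, (0 : H) ∈ hadd y w → x ∈ hadd y z → z ∈ hadd x w
  mul_hadd : ∀ a b c, (fun x => a * x) '' hadd b c = hadd (a * b) (a * c)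
  one_ne_zero : (1 : H) ≠ 0
  exists_inv : ∀ a : H, a ≠ 0 → ∃ b, a * b = 1

/-- Two hyperfields are isomorphic: there is a bijection that respects multiplication and
hyperaddition (it then also maps `0` to `0` and `1` to `1`). -/
def HyperfieldIso (H K : Type*) [Hyperfield H] [Hyperfield K] : Prop :=
  ∃ e : H ≃* K, ∀ a b, e '' Hyperfield.hadd a b = Hyperfield.hadd (e a) (e b)

theorem HyperfieldIso.refl (H : Type*) [Hyperfield H] : HyperfieldIso H H :=
  ⟨MulEquiv.refl H, fun a b => by simp⟩

theorem HyperfieldIso.symm {H K : Type*} [Hyperfield H] [Hyperfield K]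
    (h : HyperfieldIso H K) : HyperfieldIso K H := by
  obtain ⟨e, he⟩ := h
  refine ⟨e.symm, fun a b => ?_⟩
  have h1 := he (e.symm a) (e.symm b)
  rw [e.apply_symm_apply, e.apply_symm_apply] at h1
  rw [← h1, Set.image_image]
  simp

theorem HyperfieldIso.trans {H K L : Type*} [Hyperfield H] [Hyperfield K] [Hyperfield L]
    (h : HyperfieldIso H K) (h' : HyperfieldIso K L) : HyperfieldIso H L := by
  obtain ⟨e, he⟩ := h
  obtain ⟨f, hf⟩ := h'
  refine ⟨e.trans f, fun a b => ?_⟩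
  have h1 := hf (e a) (e b)
  rw [← he, Set.image_image] at h1
  simpa using h1

section QuotientHyperfield

variable {F : Type*} [Field F]

/-- The orbit relation of a subgroup `G ≤ Fˣ` acting on `F` by multiplication, as a
multiplicative congruence: `a ~ b` iff `b = a * g` for some `g ∈ G`. -/
def unitsCon (G : Subgroup Fˣ) : Con F where
  r a b := ∃ g ∈ G, b = a * (g : F)
  iseqv :=
    { refl := fun a => ⟨1, G.one_mem, by simp⟩
      symm := by
        rintro a b ⟨g, hg, rfl⟩
        exact ⟨g⁻¹, G.inv_mem hg, by simp⟩
      trans := by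
        rintro a b c ⟨g, hg, rfl⟩ ⟨h, hh, rfl⟩
        exact ⟨g * h, G.mul_mem hg hh, by simp [mul_assoc]⟩ }
  mul' := by
    rintro a b c d ⟨g, hg, rfl⟩ ⟨h, hh, rfl⟩
    exact ⟨g * h, G.mul_mem hg hh, by push_cast; ring⟩

/-- The set `F / G` of orbits of `G` on `F`, with the multiplication `[a] * [b] = [a * b]`. -/
abbrev FieldQuotient (G : Subgroup Fˣ) : Type _ := (unitsCon G).Quotient

/-- The orbit of `a`. -/
def orb (G : Subgroup Fˣ) (a : F) : FieldQuotient G := (unitsCon G).mk' a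

theorem orb_eq {G : Subgroup Fˣ} {a b : F} : orb G a = orb G b ↔ ∃ g ∈ G, b = a * (g : F) :=
  (unitsCon G).eq

theorem orb_surjective (G : Subgroup Fˣ) : Function.Surjective (orb G) :=
  (unitsCon G).mk'_surjective

theorem orb_mul (G : Subgroup Fˣ) (a b : F) : orb G (a * b) = orb G a * orb G b := rfl

theorem orb_one (G : Subgroup Fˣ) : orb G (1 : F) = 1 := rfl

theorem orb_eq_orb_zero {G : Subgroup Fˣ} {a : F} : orb G a = orb G 0 ↔ a = 0 := by
  constructor
  · intro h
    obtain ⟨g, -, h⟩ := orb_eq.1 h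
    simpa using h.symm
  · rintro rfl; rfl

/-- The hyperaddition of `F / G`: the set of orbits of sums of elements of the two orbits. -/
def orbAdd (G : Subgroup Fˣ) (x y : FieldQuotient G) : Set (FieldQuotient G) :=
  {z | ∃ a b : F, orb G a = x ∧ orb G b = y ∧ orb G (a + b) = z}

/-- `[a] + [b] = {[c] | c = a g₁ + b g₂ for some g₁, g₂ ∈ G}`. -/
theorem orbAdd_orb (G : Subgroup Fˣ) (a b : F) :
    orbAdd G (orb G a) (orb G b) =
      {z | ∃ c : F, orb G c = z ∧ ∃ g₁ ∈ G, ∃ g₂ ∈ G, c = a * (g₁ : F) + b * (g₂ : F)} := by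
  ext z
  constructor
  · rintro ⟨a', b', ha, hb, hz⟩
    obtain ⟨g, hg, rfl⟩ := orb_eq.1 ha.symm
    obtain ⟨h, hh, rfl⟩ := orb_eq.1 hb.symm
    exact ⟨_, hz, g, hg, h, hh, rfl⟩
  · rintro ⟨c, hz, g, hg, h, hh, rfl⟩
    exact ⟨_, _, (orb_eq.2 ⟨g, hg, rfl⟩).symm, (orb_eq.2 ⟨h, hh, rfl⟩).symm, hz⟩

theorem orbAdd_assoc_aux (G : Subgroup Fˣ) (x y z : FieldQuotient G) (w : FieldQuotient G) :
    (w ∈ ⋃ u ∈ orbAdd G x y, orbAdd G u z) ↔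
      ∃ a b c : F, orb G a = x ∧ orb G b = y ∧ orb G c = z ∧ orb G (a + b + c) = w := by
  simp only [Set.mem_iUnion, exists_prop]
  constructor
  · rintro ⟨u, ⟨a, b, rfl, rfl, rfl⟩, d, c, hd, rfl, rfl⟩
    obtain ⟨g, hg, rfl⟩ := orb_eq.1 hd.symm
    exact ⟨a * g, b * g, c, (orb_eq.2 ⟨g, hg, rfl⟩).symm, (orb_eq.2 ⟨g, hg, rfl⟩).symm, rfl,
      by rw [add_mul]⟩
  · rintro ⟨a, b, c, rfl, rfl, rfl, rfl⟩
    exact ⟨_, ⟨a, b, rfl, rfl, rfl⟩, _, c, rfl, rfl, rfl⟩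

theorem orbAdd_comm (G : Subgroup Fˣ) (x y : FieldQuotient G) :
    orbAdd G x y = orbAdd G y x := by
  ext z
  constructor <;>
  · rintro ⟨a, b, ha, hb, hz⟩
    exact ⟨b, a, hb, ha, by rwa [add_comm]⟩

/-- The quotient hyperfield `F / G`. -/
instance quotientHyperfield (G : Subgroup Fˣ) : Hyperfield (FieldQuotient G) where
  zero := orb G 0
  zero_mul := by
    intro x
    obtain ⟨a, rfl⟩ := orb_surjective G x
    change orb G 0 * orb G a = orb G 0
    rw [← orb_mul, zero_mul]
  mul_zero := by
    intro x
    obtain ⟨a, rfl⟩ := orb_surjective G x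
    change orb G a * orb G 0 = orb G 0
    rw [← orb_mul, mul_zero]
  hadd := orbAdd G
  hadd_nonempty := by
    intro x y
    obtain ⟨a, rfl⟩ := orb_surjective G x
    obtain ⟨b, rfl⟩ := orb_surjective G y
    exact ⟨_, a, b, rfl, rfl, rfl⟩
  hadd_comm := orbAdd_comm G
  hadd_assoc := by
    intro x y z
    ext w
    have h : (⋃ u ∈ orbAdd G y z, orbAdd G x u) = ⋃ u ∈ orbAdd G y z, orbAdd G u x := by
      simp only [orbAdd_comm G x]
    rw [h, orbAdd_assoc_aux, orbAdd_assoc_aux]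
    constructor
    · rintro ⟨a, b, c, ha, hb, hc, hw⟩
      exact ⟨b, c, a, hb, hc, ha, by rw [← hw]; congr 1; ring⟩
    · rintro ⟨b, c, a, hb, hc, ha, hw⟩
      exact ⟨a, b, c, ha, hb, hc, by rw [← hw]; congr 1; ring⟩
  zero_hadd := by
    intro x
    ext z
    constructor
    · rintro ⟨a, b, ha, rfl, rfl⟩
      have ha : a = 0 := orb_eq_orb_zero.1 ha
      simp [ha]
    · rintro rfl
      obtain ⟨b, rfl⟩ := orb_surjective G z
      exact ⟨0, b, rfl, rfl, by rw [zero_add]⟩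
  existsUnique_neg := by
    intro x
    obtain ⟨a, rfl⟩ := orb_surjective G x
    refine ⟨orb G (-a), ⟨a, -a, rfl, rfl, by rw [add_neg_cancel]; rfl⟩, ?_⟩
    rintro y ⟨a', b, ha, rfl, h0⟩
    have h0 : a' + b = 0 := orb_eq_orb_zero.1 h0
    obtain ⟨g, hg, rfl⟩ := orb_eq.1 ha
    exact orb_eq.2 ⟨g, hg, by linear_combination -(g : F) * h0⟩
  reversible := by
    rintro x y z w ⟨a, b, rfl, rfl, h0⟩ ⟨a', c, ha, rfl, rfl⟩
    have h0 : a + b = 0 := orb_eq_orb_zero.1 h0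
    obtain ⟨g, hg, rfl⟩ := orb_eq.1 ha.symm
    exact ⟨a * g + c, b * g, rfl, (orb_eq.2 ⟨g, hg, rfl⟩).symm,
      congrArg _ (by linear_combination (g : F) * h0)⟩
  mul_hadd := by
    intro x y z
    obtain ⟨a, rfl⟩ := orb_surjective G x
    ext w
    constructor
    · rintro ⟨_, ⟨b, c, rfl, rfl, rfl⟩, rfl⟩
      exact ⟨a * b, a * c, orb_mul G a b, orb_mul G a c, by rw [← mul_add, orb_mul]⟩
    · obtain ⟨b, rfl⟩ := orb_surjective G y
      obtain ⟨c, rfl⟩ := orb_surjective G z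
      rw [← orb_mul, ← orb_mul, orbAdd_orb]
      rintro ⟨_, rfl, g, hg, h, hh, rfl⟩
      refine ⟨orb G (b * g + c * h), ?_, ?_⟩
      · rw [orbAdd_orb]
        exact ⟨_, rfl, g, hg, h, hh, rfl⟩
      · change orb G a * orb G (b * g + c * h) = _
        rw [← orb_mul]
        congr 1
        ring
  one_ne_zero := fun h => one_ne_zero (orb_eq_orb_zero.1 h : (1 : F) = 0)
  exists_inv := by
    intro x hx
    obtain ⟨a, rfl⟩ := orb_surjective G x
    have ha : a ≠ 0 := fun h => hx (h ▸ rfl)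
    exact ⟨orb G a⁻¹, by rw [← orb_mul, mul_inv_cancel₀ ha, orb_one]⟩

end QuotientHyperfield

/-- A hyperfield is a quotient hyperfield if it is isomorphic to `F / G` for some field `F` and
some subgroup `G` of `Fˣ`. -/
def IsQuotientHyperfield (H : Type*) [Hyperfield H] : Prop :=
  ∃ (F : Type u) (_ : Field F) (G : Subgroup Fˣ), HyperfieldIso H (FieldQuotient G)

/-- Hyperfields with exactly `n` elements (for `n ≥ 1`). -/
structure HyperfieldOfOrder (n : ℕ) where
  carrier : Type
  [str : Hyperfield carrier]
  card_eq : Nat.card carrier = n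

attribute [instance] HyperfieldOfOrder.str

/-- Isomorphism of hyperfields with `n` elements. -/
instance hyperfieldSetoid (n : ℕ) : Setoid (HyperfieldOfOrder n) where
  r X Y := HyperfieldIso X.carrier Y.carrier
  iseqv :=
    { refl := fun X => HyperfieldIso.refl X.carrier
      symm := fun h => h.symm
      trans := fun h h' => h.trans h' }

/-- Isomorphism classes of hyperfields with `n` elements. -/
abbrev HyperfieldClass (n : ℕ) : Type 1 := Quotient (hyperfieldSetoid n)

/-- The isomorphism classes of hyperfields with `n` elements that consist of quotient
hyperfields. -/
def quotientClasses (n : ℕ) : Set (HyperfieldClass n) :=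
  {c | ∃ X : HyperfieldOfOrder n, IsQuotientHyperfield.{u} X.carrier ∧ ⟦X⟧ = c}

/-- `H_r`: the number of isomorphism classes of hyperfields of order `r + 1`. -/
noncomputable def numHyperfields (r : ℕ) : ℕ := Nat.card (HyperfieldClass (r + 1))

/-- `Q_r`: the number of isomorphism classes of quotient hyperfields of order `r + 1`. -/
noncomputable def numQuotientHyperfields (r : ℕ) : ℕ :=
  (quotientClasses.{u} (r + 1)).ncard

/-! In a hyperfield with an odd number `r` of units, `-1 = 1`. Its addition is then encoded by a
symmetric, scaling invariant ternary relation on the unit group `G`, that is, by a Boolean function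
on the set `TripleClass G` of unordered triples up to scaling; let `N` be the size of this set.
Conversely, a function whose relation is rich, so that any two sums of nonzero elements share a
nonzero element, gives a hyperfield on `WithZero G`.

A union bound shows that for large `r` at least half of the `2 ^ N` functions are rich
(`two_pow_le_two_mul_card_rich`). Each isomorphism class arises from at most `(r + 1) ^ log₂ r` of
them, since a group with `r` elements has few automorphisms (`card_rich_le`). So there are nearly `2
^ N` classes over each `G`, up to a factor `2 ^ O(log² r)`.

Quotient hyperfields are special: `1 + 1` is everything whenever the field is infinite (a Ramsey and
pigeonhole argument) or has more than `16 r ^ 4` elements (a second moment argument). The condition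
`1 + 1 = H` fixes the function on at least `r / 3` triple classes, which costs a factor `2 ^ (r /
3)` (`card_full_mul_two_pow_le`). The remaining quotients come from small finite fields and are
determined by the size of the field, so they number only `O(r ^ 4)`. Summing over the possible
multiplicative groups, the saving `2 ^ (r / 3)` beats every other factor. -/

namespace Hyperfield

/-! ### Units, negatives and symmetry of the addition when `-1 = 1` -/

section Basic

variable {H : Type*} [Hyperfield H]

instance : Nontrivial H := ⟨1, 0, one_ne_zero⟩

theorem isUnit_or_eq_zero (a : H) : IsUnit a ∨ a = 0 := by
  by_cases h : a = 0
  · exact Or.inr h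
  · obtain ⟨b, hb⟩ := exists_inv a h
    exact Or.inl (IsUnit.of_mul_eq_one b hb)

/-- The nonzero elements of a hyperfield are units. -/
@[reducible] noncomputable def commGroupWithZero (H : Type*) [Hyperfield H] :
    CommGroupWithZero H :=
  commGroupWithZeroOfIsUnitOrEqZero isUnit_or_eq_zero

theorem hadd_zero (a : H) : hadd a 0 = {a} := by rw [hadd_comm, zero_hadd]

theorem nonempty_mulEquiv_withZero_units (H : Type*) [Hyperfield H] :
    Nonempty (H ≃* WithZero Hˣ) := by
  classical
  let _ := commGroupWithZero H
  exact ⟨(WithZero.withZeroUnitsEquiv (G := H)).symm⟩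

theorem natCard_units_add_one (H : Type*) [Hyperfield H] [Finite H] :
    Nat.card Hˣ + 1 = Nat.card H := by
  obtain ⟨e⟩ := nonempty_mulEquiv_withZero_units H
  rw [Nat.card_congr e.toEquiv]
  exact (Finite.card_option (α := Hˣ)).symm

/-- Uniqueness of negatives gives `(-1) * (-1) = 1`, and a group of odd order has no element of
order two. -/
theorem zero_mem_one_hadd_one [Finite H] (h : Odd (Nat.card Hˣ)) : (0 : H) ∈ hadd (1 : H) 1 := by
  obtain ⟨y, hy, -⟩ := existsUnique_neg (1 : H)
  have h2 : (0 : H) ∈ hadd y (y * y) := by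
    have := Set.mem_image_of_mem (fun x => y * x) hy
    rw [mul_hadd, mul_one] at this
    simpa using this
  have hyy : y * y = 1 := by
    rw [hadd_comm] at hy
    exact (existsUnique_neg y).unique h2 hy
  let v : Hˣ := ⟨y, y, hyy, hyy⟩
  have hv : v ^ 2 = 1 := Units.ext (by simpa [v, pow_two] using hyy)
  have h1 : v = 1 := by
    rw [← orderOf_eq_one_iff]
    have d1 := orderOf_dvd_of_pow_eq_one hv
    have d2 := orderOf_dvd_natCard v
    exact Nat.dvd_one.1 ((Nat.coprime_two_left.2 h) ▸ Nat.dvd_gcd d1 d2)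
  have : y = 1 := congrArg Units.val h1
  rwa [this] at hy

theorem zero_mem_hadd_self (h : (0 : H) ∈ hadd (1 : H) 1) (a : H) : (0 : H) ∈ hadd a a := by
  have := Set.mem_image_of_mem (fun x => a * x) h
  rw [mul_hadd, mul_one] at this
  simpa using this

theorem zero_mem_hadd_iff (h : (0 : H) ∈ hadd (1 : H) 1) {a b : H} :
    (0 : H) ∈ hadd a b ↔ a = b := by
  constructor
  · intro h'
    exact (existsUnique_neg a).unique (zero_mem_hadd_self h a) h'
  · rintro rfl
    exact zero_mem_hadd_self h a

/-- Reversibility with `-a = a`. Together with commutativity it makes `c ∈ a + b` invariant under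
all permutations of the three elements. -/
theorem mem_hadd_rotate (h : (0 : H) ∈ hadd (1 : H) 1) {a b c : H} (hc : c ∈ hadd a b) :
    b ∈ hadd a c := by
  rw [hadd_comm]
  exact reversible c a b a (zero_mem_hadd_self h a) hc

theorem mem_hadd_mul {a b c : H} (g : H) (hc : c ∈ hadd a b) :
    g * c ∈ hadd (g * a) (g * b) := by
  rw [← mul_hadd]
  exact Set.mem_image_of_mem _ hc

end Basic

/-- Once `-1 = 1`, membership in a sum is forced whenever one of the three elements is zero, so only
nonzero triples carry information. -/
theorem iso_of_mulEquiv {H K : Type*} [Hyperfield H] [Hyperfield K]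
    (hH : (0 : H) ∈ hadd (1 : H) 1) (hK : (0 : K) ∈ hadd (1 : K) 1) (e : H ≃* K)
    (he : ∀ a b c : H, a ≠ 0 → b ≠ 0 → c ≠ 0 → (c ∈ hadd a b ↔ e c ∈ hadd (e a) (e b))) :
    HyperfieldIso H K := by
  have key : ∀ a b c : H, c ∈ hadd a b ↔ e c ∈ hadd (e a) (e b) := by
    intro a b c
    have e0 : e 0 = 0 := map_zero e
    by_cases ha : a = 0
    · simp [ha, e0, zero_hadd]
    by_cases hb : b = 0
    · simp [hb, e0, hadd_zero]
    by_cases hc : c = 0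
    · simp [hc, e0, zero_mem_hadd_iff hH, zero_mem_hadd_iff hK]
    exact he a b c ha hb hc
  refine ⟨e, fun a b => ?_⟩
  ext z
  obtain ⟨z, rfl⟩ := e.surjective z
  rw [← key, e.injective.mem_set_image]

end Hyperfield

/-! ### Hyperfields built from rich ternary relations -/

section OfTernaryRelation

variable {G : Type*}

/-- A symmetric, scaling invariant ternary relation on `G` which is rich enough for the
hyperaddition `a + b = {c | T a b c} ∪ {0 | a = b}` to be associative. -/
structure IsRichRelation [Mul G] (T : G → G → G → Prop) : Prop where
  swap : ∀ a b c, T a b c → T b a c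
  rotate : ∀ a b c, T a b c → T a c b
  scale : ∀ g a b c, T a b c → T (g * a) (g * b) (g * c)
  rich : ∀ a b c d, ∃ x, T a b x ∧ T c d x

/-- The hyperaddition on `WithZero G` defined by a ternary relation. -/
def relAdd (T : G → G → G → Prop) : WithZero G → WithZero G → Set (WithZero G)
  | none, y => {y}
  | some a, none => {(a : WithZero G)}
  | some a, some b => {z | (∃ c : G, z = c ∧ T a b c) ∨ (z = 0 ∧ a = b)}

theorem relAdd_zero_left (T : G → G → G → Prop) (y : WithZero G) : relAdd T 0 y = {y} := rfl

theorem relAdd_zero_right (T : G → G → G → Prop) (y : WithZero G) : relAdd T y 0 = {y} := by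
  cases y <;> rfl

theorem coe_mem_relAdd {T : G → G → G → Prop} {a b c : G} :
    (c : WithZero G) ∈ relAdd T a b ↔ T a b c := by
  change ((∃ d : G, (c : WithZero G) = d ∧ T a b d) ∨ ((c : WithZero G) = 0 ∧ a = b)) ↔ _
  simp

theorem zero_mem_relAdd {T : G → G → G → Prop} {a b : G} :
    (0 : WithZero G) ∈ relAdd T a b ↔ a = b := by
  change ((∃ d : G, (0 : WithZero G) = d ∧ T a b d) ∨ ((0 : WithZero G) = 0 ∧ a = b)) ↔ _
  simp

variable [CommGroup G]

theorem IsRichRelation.relAdd_comm {T : G → G → G → Prop} (h : IsRichRelation T)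
    (x y : WithZero G) : relAdd T x y = relAdd T y x := by
  induction x with
  | zero => rw [relAdd_zero_left, relAdd_zero_right]
  | coe a =>
    induction y with
    | zero => rw [relAdd_zero_left, relAdd_zero_right]
    | coe b =>
      ext z
      induction z with
      | zero => rw [zero_mem_relAdd, zero_mem_relAdd, eq_comm]
      | coe c => rw [coe_mem_relAdd, coe_mem_relAdd]; exact ⟨h.swap _ _ _, h.swap _ _ _⟩

/-- Richness puts every nonzero element into `(a + b) + c`, and zero lies there exactly when `T a b
c`. This description is symmetric in `a`, `b`, `c`, whence associativity. -/
theorem IsRichRelation.mem_iUnion_relAdd {T : G → G → G → Prop} (h : IsRichRelation T)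
    (a b c : G) (z : WithZero G) :
    z ∈ (⋃ x ∈ relAdd T a b, relAdd T x c) ↔ (z = 0 → T a b c) := by
  simp only [Set.mem_iUnion, exists_prop]
  induction z with
  | zero =>
    simp only [forall_const]
    constructor
    · rintro ⟨x, hx, hz⟩
      induction x with
      | zero => rw [relAdd_zero_left] at hz; simp at hz
      | coe x => rw [zero_mem_relAdd] at hz; rwa [coe_mem_relAdd, hz] at hx
    · intro ht
      exact ⟨c, coe_mem_relAdd.2 ht, zero_mem_relAdd.2 rfl⟩
  | coe d =>
    simp only [WithZero.coe_ne_zero, false_imp_iff, iff_true]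
    obtain ⟨x, h1, h2⟩ := h.rich a b c d
    exact ⟨x, coe_mem_relAdd.2 h1, coe_mem_relAdd.2 (h.swap _ _ _ (h.rotate _ _ _ h2))⟩

/-- The hyperfield on `WithZero G` defined by a rich relation. -/
@[reducible] noncomputable def IsRichRelation.hyperfield {T : G → G → G → Prop} (h : IsRichRelation T) :
    Hyperfield (WithZero G) where
  hadd := relAdd T
  hadd_nonempty x y := by
    induction x with
    | zero => rw [relAdd_zero_left]; exact Set.singleton_nonempty _
    | coe a =>
      induction y with
      | zero => rw [relAdd_zero_right]; exact Set.singleton_nonempty _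
      | coe b =>
        obtain ⟨x, h1, -⟩ := h.rich a b a b
        exact ⟨x, coe_mem_relAdd.2 h1⟩
  hadd_comm := h.relAdd_comm
  hadd_assoc x y z := by
    induction x with
    | zero => simp [relAdd_zero_left]
    | coe a =>
      induction y with
      | zero => simp [relAdd_zero_left, relAdd_zero_right]
      | coe b =>
        induction z with
        | zero => simp [relAdd_zero_right]
        | coe c =>
          have h1 : (⋃ x ∈ relAdd T b c, relAdd T a x) = ⋃ x ∈ relAdd T b c, relAdd T x a := by
            simp only [h.relAdd_comm a]
          ext z
          rw [h1, h.mem_iUnion_relAdd, h.mem_iUnion_relAdd]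
          exact imp_congr_right fun _ =>
            ⟨fun t => h.rotate _ _ _ (h.swap _ _ _ t), fun t => h.swap _ _ _ (h.rotate _ _ _ t)⟩
  zero_hadd := relAdd_zero_left T
  existsUnique_neg x := by
    refine ⟨x, ?_, fun y hy => ?_⟩
    · induction x with
      | zero => exact rfl
      | coe a => exact zero_mem_relAdd.2 rfl
    · induction x with
      | zero => exact (Set.mem_singleton_iff.1 hy).symm
      | coe a =>
        induction y with
        | zero =>
          change _ ∈ relAdd T _ _ at hy
          rw [relAdd_zero_right] at hy
          exact hy
        | coe b => exact congrArg _ (zero_mem_relAdd.1 hy).symm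
  reversible x y z w hw hx := by
    have hyw : w = y := by
      induction y with
      | zero => exact (Set.mem_singleton_iff.1 hw).symm
      | coe a =>
        induction w with
        | zero => rw [relAdd_zero_right] at hw; exact hw
        | coe b => exact congrArg _ (zero_mem_relAdd.1 hw).symm
    subst hyw
    induction w with
    | zero =>
      rw [relAdd_zero_left, Set.mem_singleton_iff] at hx
      rw [relAdd_zero_right, hx]; rfl
    | coe a =>
      induction z with
      | zero =>
        rw [relAdd_zero_right, Set.mem_singleton_iff] at hx
        rw [hx]; exact zero_mem_relAdd.2 rfl
      | coe b =>
        induction x with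
        | zero => rw [relAdd_zero_left, zero_mem_relAdd.1 hx]; rfl
        | coe c =>
          rw [coe_mem_relAdd] at hx ⊢
          exact h.swap _ _ _ (h.rotate _ _ _ hx)
  mul_hadd x y z := by
    induction x with
    | zero =>
      simp only [zero_mul, relAdd_zero_left]
      have : (relAdd T y z).Nonempty := by
        induction y with
        | zero => rw [relAdd_zero_left]; exact Set.singleton_nonempty _
        | coe a =>
          induction z with
          | zero => rw [relAdd_zero_right]; exact Set.singleton_nonempty _
          | coe b =>
            obtain ⟨x, h1, -⟩ := h.rich a b a b
            exact ⟨x, coe_mem_relAdd.2 h1⟩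
      exact this.image_const 0
    | coe g =>
      induction y with
      | zero => simp [relAdd_zero_left]
      | coe a =>
        induction z with
        | zero => simp [relAdd_zero_right]
        | coe b =>
          rw [← WithZero.coe_mul, ← WithZero.coe_mul]
          ext w
          induction w with
          | zero =>
            rw [zero_mem_relAdd]
            constructor
            · rintro ⟨v, hv, hv0⟩
              have : v = 0 := by simpa using hv0
              rw [this, zero_mem_relAdd] at hv
              rw [hv]
            · intro hab
              exact ⟨0, zero_mem_relAdd.2 (mul_left_cancel hab), mul_zero _⟩
          | coe d =>
            rw [coe_mem_relAdd]
            constructor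
            · rintro ⟨v, hv, hvd⟩
              induction v with
              | zero => simp at hvd
              | coe c =>
                have : g * c = d := by
                  have : ((g * c : G) : WithZero G) = d := hvd
                  exact WithZero.coe_inj.1 this
                rw [← this]
                exact h.scale _ _ _ _ (coe_mem_relAdd.1 hv)
            · intro ht
              refine ⟨((g⁻¹ * d : G) : WithZero G), coe_mem_relAdd.2 ?_, ?_⟩
              · simpa using h.scale g⁻¹ _ _ _ ht
              · change ((g * (g⁻¹ * d) : G) : WithZero G) = d
                rw [mul_inv_cancel_left]
  one_ne_zero := one_ne_zero
  exists_inv a ha := ⟨a⁻¹, mul_inv_cancel₀ ha⟩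

end OfTernaryRelation

/-! ### Quotients of infinite fields: `1 + 1` is everything -/

section InfiniteField

/-- Ramsey's theorem, for a symmetric colouring of the pairs of an infinite set and prescribed sizes
of the homogeneous sets. -/
theorem exists_homogeneous_finset {V C : Type*} [Finite C] (col : V → V → C)
    (hcol : ∀ x y, col x y = col y x) (N : ℕ) (n : C → ℕ) (hn : ∑ᶠ c, n c = N)
    (S : Set V) (hS : S.Infinite) :
    ∃ c, ∃ T : Finset V, (T : Set V) ⊆ S ∧ T.card = n c ∧
      ∀ x ∈ T, ∀ y ∈ T, x ≠ y → col x y = c := by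
  classical
  have := Fintype.ofFinite C
  induction N generalizing n S with
  | zero =>
    obtain ⟨x, -⟩ := hS.nonempty
    rw [finsum_eq_sum_of_fintype, Finset.sum_eq_zero_iff] at hn
    exact ⟨col x x, ∅, by simp, by simp [hn], by simp⟩
  | succ N ih =>
    obtain ⟨x, hx⟩ := hS.nonempty
    have hS' : (S \ {x}).Infinite := hS.sdiff (Set.finite_singleton x)
    have := hS'.to_subtype
    obtain ⟨c, hc⟩ := Finite.exists_infinite_fiber (fun y : ↥(S \ {x}) => col x y)
    -- A colour of which nothing is demanded is served by the empty set. Otherwise the demand for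
    -- `c` drops by one inside the `c`-neighbours of `x`, because `x` can be added to any
    -- `c`-homogeneous set found there.
    by_cases hnc : n c = 0
    · exact ⟨c, ∅, by simp, by simp [hnc], by simp⟩
    set S₁ : Set V := Subtype.val '' ((fun y : ↥(S \ {x}) => col x y) ⁻¹' {c}) with hS₁
    have hS₁inf : S₁.Infinite :=
      (Set.infinite_coe_iff.1 hc).image Subtype.val_injective.injOn
    have hsub : S₁ ⊆ S \ {x} := by rintro _ ⟨y, -, rfl⟩; exact y.2
    have hcol₁ : ∀ y ∈ S₁, col x y = c := by rintro _ ⟨y, hy, rfl⟩; exact hy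
    obtain ⟨d, T, hTS, hT, hTd⟩ := ih (Function.update n c (n c - 1)) (by
      rw [finsum_eq_sum_of_fintype] at hn ⊢
      rw [← Finset.add_sum_erase _ _ (Finset.mem_univ c)] at hn ⊢
      rw [Function.update_self, Finset.sum_congr rfl (g := n)]
      · have : 1 ≤ n c := Nat.one_le_iff_ne_zero.2 hnc
        have hsum : n c + (Finset.univ.erase c).sum n = N + 1 := hn
        omega
      · intro i hi
        rw [Function.update_of_ne (Finset.ne_of_mem_erase hi)]) S₁ hS₁inf
    by_cases hdc : d = c
    · subst hdc
      have hxT : x ∉ T := fun h => (hsub (hTS h)).2 rfl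
      refine ⟨d, insert x T, ?_, ?_, ?_⟩
      · intro y hy
        rcases Finset.mem_insert.1 (Finset.mem_coe.1 hy) with rfl | hy
        · exact hx
        · exact (hsub (hTS hy)).1
      · rw [Finset.card_insert_of_notMem hxT, hT, Function.update_self]; omega
      · intro y hy z hz hyz
        rcases Finset.mem_insert.1 hy with rfl | hy <;> rcases Finset.mem_insert.1 hz with rfl | hz
        · exact absurd rfl hyz
        · exact hcol₁ _ (hTS hz)
        · rw [hcol]; exact hcol₁ _ (hTS ‹y ∈ T›)
        · exact hTd y hy z hz hyz
    · rw [Function.update_of_ne hdc] at hT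
      exact ⟨d, T, fun y hy => (hsub (hTS hy)).1, hT, hTd⟩

variable {F : Type*} [Field F]

theorem orb_neg {G : Subgroup Fˣ} (h : orb G (-1 : F) = orb G 1) (a : F) :
    orb G (-a) = orb G a := by
  rw [← neg_one_mul, orb_mul, h, ← orb_mul, one_mul]

/-- In an infinite field, every element is a difference of two elements of a subgroup of finite
index that contains `-1`, up to an element of the subgroup. -/
theorem orb_mem_orbAdd_one_one_of_infinite [Infinite F] {G : Subgroup Fˣ}
    [Finite (FieldQuotient G)] (h : orb G (-1 : F) = orb G 1) {c : F} (hc : c ≠ 0) :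
    orb G c ∈ orbAdd G (orb G 1) (orb G 1) := by
  classical
  have := Fintype.ofFinite (FieldQuotient G)
  set Q := FieldQuotient G
  set n := Fintype.card Q with hn
  -- The colouring by orbits of differences is symmetric because `-1` lies in the orbit of `1`. The
  -- result is `n + 1` elements whose differences all lie in one orbit.
  obtain ⟨b, T, -, hT, hTb⟩ := exists_homogeneous_finset (fun x y : F => orb G (x - y))
    (fun x y => by rw [← orb_neg h, neg_sub]) _ (fun _ => n + 1) rfl Set.univ Set.infinite_univ
  have hn1 : 1 ≤ n := Fintype.card_pos_iff.2 ⟨orb G 1⟩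
  have hb : b ≠ orb G 0 := by
    rintro rfl
    obtain ⟨x, hx, y, hy, hxy⟩ := Finset.one_lt_card.1 (by omega : 1 < T.card)
    exact hxy (sub_eq_zero.1 (orb_eq_orb_zero.1 (hTb x hx y hy hxy)))
  obtain ⟨β, rfl⟩ := orb_surjective G b
  have hβ : β ≠ 0 := by rintro rfl; exact hb rfl
  obtain ⟨rep, hrep⟩ := (orb_surjective G).hasRightInverse
  -- Chosen so that `k a` times a difference of two elements of `T` lies in the orbit of `rep a *
  -- c`. The value `1` at the zero orbit only keeps `k` nonvanishing.
  let k : Q → F := fun a => (if a = orb G 0 then 1 else rep a) * (c / β)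
  have hk : ∀ a, k a ≠ 0 := by
    intro a
    refine mul_ne_zero ?_ (div_ne_zero hc hβ)
    split_ifs with h0
    · exact one_ne_zero
    · intro h1
      exact h0 (by rw [← hrep a, h1])
  let v : (Q → T) → F := fun p => ∑ a, k a * p a
  -- Record the orbit `a` of `v p` and forget the coordinate of `p` at `a`. There are `(n + 1) ^ n`
  -- choices of `p` but only `n * (n + 1) ^ (n - 1)` records. A collision gives two values of `v` in
  -- the same orbit `a` whose difference is `k a` times a difference in `T`; dividing by `rep a`
  -- writes an element of the orbit of `c` as a difference of two elements of `G`.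
  let φ : (Q → T) → Σ a : Q, ({d : Q // d ≠ a} → T) := fun p => ⟨orb G (v p), fun d => p d⟩
  obtain ⟨p, p', hpp, hφ⟩ := Fintype.exists_ne_map_eq_of_card_lt φ (by
    simp only [Fintype.card_sigma, Fintype.card_fun, Fintype.card_coe, hT,
      Fintype.card_subtype_compl, Fintype.card_subtype_eq, Finset.sum_const, Finset.card_univ,
      smul_eq_mul, ← hn]
    obtain ⟨m, hm⟩ := Nat.exists_eq_add_of_le' hn1
    rw [hm, Nat.add_sub_cancel, pow_succ (m + 1 + 1) m, mul_comm]
    exact Nat.mul_lt_mul_of_pos_left (by omega) (by positivity))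
  have hcol : orb G (v p) = orb G (v p') := congrArg Sigma.fst hφ
  have hoff : ∀ d, d ≠ orb G (v p) → p d = p' d := by
    intro d hd
    have h2 : ∀ s t : Σ a : Q, ({d : Q // d ≠ a} → T), s = t →
        ∀ d (h1 : d ≠ s.1) (h2 : d ≠ t.1), s.2 ⟨d, h1⟩ = t.2 ⟨d, h2⟩ := by
      rintro s t rfl d h1 h2; rfl
    exact h2 _ _ hφ d hd (fun h => hd (h.trans hcol.symm))
  set a := orb G (v p) with ha
  have hpa : (p a : F) ≠ p' a := by
    intro h1
    apply hpp
    funext d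
    by_cases hd : d = a
    · rw [hd]; exact Subtype.ext h1
    · exact hoff d hd
  have hdiff : v p - v p' = k a * (p a - p' a) := by
    simp only [v, ← Finset.sum_sub_distrib, ← mul_sub]
    refine Finset.sum_eq_single a (fun d _ hd => ?_) (fun h => absurd (Finset.mem_univ _) h)
    rw [hoff d hd, sub_self, mul_zero]
  have hne : v p - v p' ≠ 0 := by
    rw [hdiff]; exact mul_ne_zero (hk a) (sub_ne_zero.2 hpa)
  -- The zero orbit is a single point, so there the two values of `v` would coincide.
  have ha0 : a ≠ orb G 0 := by
    intro h0
    rw [ha, orb_eq_orb_zero] at h0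
    have h1 : v p' = 0 := by
      rw [← orb_eq_orb_zero (G := G), ← hcol, ha, h0]
    exact hne (by rw [h0, h1, sub_self])
  have hr0 : rep a ≠ 0 := by
    intro h1
    exact ha0 (by rw [← hrep a, h1])
  have hk' : k a = rep a * (c / β) := by simp only [k, if_neg ha0]
  have hc' : orb G c = orb G ((rep a)⁻¹ * (v p - v p')) := by
    rw [hdiff, hk', show (rep a)⁻¹ * (rep a * (c / β) * ((p a : F) - p' a)) =
      c * β⁻¹ * (p a - p' a) by field_simp, orb_mul, hTb _ (p a).2 _ (p' a).2 hpa, ← orb_mul,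
      inv_mul_cancel_right₀ hβ]
  refine ⟨(rep a)⁻¹ * v p, -((rep a)⁻¹ * v p'), ?_, ?_, by rw [hc']; congr 1; ring⟩
  · rw [orb_mul, ← ha, ← hrep a, ← orb_mul, hrep a, inv_mul_cancel₀ hr0]
  · rw [orb_neg h, orb_mul, ← hcol, ← hrep a, ← orb_mul, hrep a, inv_mul_cancel₀ hr0]

end InfiniteField

/-! ### A second moment bound for multiplicatively closed sets in finite fields -/

section FiniteField

variable {F : Type*} [Field F]

/-- If `S + S c` misses `S` for a subgroup `S` of the units of a finite field, then `S` is small. -/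
theorem card_pow_four_le_of_add_mul_notMem [Fintype F] [DecidableEq F] (S : Finset F)
    (h0 : ∀ x ∈ S, x ≠ 0) (hmul : ∀ x ∈ S, ∀ y ∈ S, x * y ∈ S) {c : F} (hc : c ≠ 0)
    (hS : ∀ x ∈ S, ∀ z ∈ S, x + c * z ∉ S) :
    S.card ^ 4 ≤ Fintype.card F ^ 3 := by
  set n : ℝ := (S.card : ℝ) with hn
  set q : ℝ := (Fintype.card F : ℝ) with hq
  have hq0 : 0 < q := by
    rw [hq]; exact_mod_cast Fintype.card_pos_iff.2 ⟨(0 : F)⟩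
  rcases Finset.eq_empty_or_nonempty S with rfl | hne
  · simp
  have hn0 : 0 < n := by rw [hn]; exact_mod_cast hne.card_pos
  let P := S ×ˢ S
  have hP : (P.card : ℝ) = n ^ 2 := by simp [P, Finset.card_product, hn, pow_two]
  let f : F → F × F → F := fun l p => p.1 + l * p.2
  -- The number of representations of `t` as `x + l * y` with `x`, `y` in `S`. Its mean over `t` is
  -- `n ^ 2 / q` for every slope `l`, and the variance is summed over all slopes.
  let h : F → F → ℝ := fun l t => ∑ p ∈ P, if f l p = t then 1 else 0
  have hsum1 : ∀ l, ∑ t, h l t = n ^ 2 := by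
    intro l
    simp only [h]
    rw [Finset.sum_comm]
    simp [hP]
  have hsum2 : ∀ l, ∑ t, h l t ^ 2 = ∑ p ∈ P, ∑ p' ∈ P, if f l p = f l p' then (1 : ℝ) else 0 := by
    intro l
    simp only [h, pow_two, Finset.sum_mul_sum]
    rw [Finset.sum_comm]
    refine Finset.sum_congr rfl fun p _ => ?_
    rw [Finset.sum_comm]
    refine Finset.sum_congr rfl fun p' _ => ?_
    simp only [ite_mul, one_mul, zero_mul, Finset.sum_ite_eq, Finset.mem_univ, if_true]
    simp only [eq_comm]
  -- Two distinct points have equal images for at most one slope.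
  have hcoll : ∀ p p' : F × F, (∑ l, if f l p = f l p' then (1 : ℝ) else 0) ≤
      (if p = p' then q else 0) + 1 := by
    intro p p'
    by_cases hpp : p = p'
    · simp [hpp, hq]
    · rw [if_neg hpp, zero_add, ← Finset.sum_filter, Finset.sum_const, nsmul_eq_mul, mul_one]
      have : (Finset.univ.filter fun l => f l p = f l p').card ≤ 1 := by
        rw [Finset.card_le_one]
        intro l hl l' hl'
        simp only [Finset.mem_filter, Finset.mem_univ, true_and, f] at hl hl'
        by_contra hll
        have h2 : p.2 = p'.2 := by
          have : (l - l') * (p.2 - p'.2) = 0 := by linear_combination hl - hl'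
          rcases mul_eq_zero.1 this with h3 | h3
          · exact absurd (sub_eq_zero.1 h3) hll
          · exact sub_eq_zero.1 h3
        exact hpp (Prod.ext (by linear_combination hl - l * h2) h2)
      exact_mod_cast this
  have htot : ∑ l, ∑ t, h l t ^ 2 ≤ q * n ^ 2 + n ^ 4 := by
    calc ∑ l, ∑ t, h l t ^ 2
        = ∑ p ∈ P, ∑ p' ∈ P, ∑ l, if f l p = f l p' then (1 : ℝ) else 0 := by
          simp only [hsum2]
          rw [Finset.sum_comm]
          exact Finset.sum_congr rfl fun p _ => Finset.sum_comm
      _ ≤ ∑ p ∈ P, ∑ p' ∈ P, ((if p = p' then q else 0) + 1) :=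
          Finset.sum_le_sum fun p _ => Finset.sum_le_sum fun p' _ => hcoll p p'
      _ = q * n ^ 2 + n ^ 4 := by
          have : ∀ p ∈ P, ∑ p' ∈ P, ((if p = p' then q else 0) + 1) = q + n ^ 2 := by
            intro p hp
            rw [Finset.sum_add_distrib, Finset.sum_ite_eq, if_pos hp, Finset.sum_const,
              nsmul_eq_mul, mul_one, hP]
          rw [Finset.sum_congr rfl this, Finset.sum_const, nsmul_eq_mul, hP]
          ring
  have hvar : ∑ l, ∑ t, (h l t - n ^ 2 / q) ^ 2 ≤ q * n ^ 2 := by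
    have : ∀ l, ∑ t, (h l t - n ^ 2 / q) ^ 2 = ∑ t, h l t ^ 2 - n ^ 4 / q := by
      intro l
      simp only [sub_sq, Finset.sum_add_distrib, Finset.sum_sub_distrib]
      rw [← Finset.sum_mul, ← Finset.mul_sum, hsum1, Finset.sum_const, nsmul_eq_mul,
        Finset.card_univ, ← hq]
      field_simp
      ring
    simp only [this, Finset.sum_sub_distrib, Finset.sum_const, nsmul_eq_mul, Finset.card_univ,
      ← hq]
    have : q * (n ^ 4 / q) = n ^ 4 := by field_simp
    linarith
  -- Multiplicative closure of `S` spreads the single missing slope `c` to all of `c * S`, so `n ^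
  -- 2` pairs `(l, t)` each deviate from the mean by `n ^ 2 / q`.
  have hzero : ∀ z ∈ S, ∀ t ∈ S, h (c * z) t = 0 := by
    intro z hz t ht
    refine Finset.sum_eq_zero fun p hp => if_neg ?_
    rintro rfl
    obtain ⟨hp1, hp2⟩ := Finset.mem_product.1 hp
    refine hS p.1 hp1 (z * p.2) (hmul z hz _ hp2) ?_
    rw [← mul_assoc]; exact ht
  have hlow : n * (n * (n ^ 2 / q) ^ 2) ≤ ∑ l, ∑ t, (h l t - n ^ 2 / q) ^ 2 := by
    calc n * (n * (n ^ 2 / q) ^ 2) = ∑ z ∈ S, ∑ t ∈ S, (h (c * z) t - n ^ 2 / q) ^ 2 := by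
          rw [Finset.sum_congr rfl fun z hz => Finset.sum_congr rfl fun t ht => by
            rw [hzero z hz t ht, zero_sub, neg_sq]]
          simp [hn]
      _ ≤ ∑ z ∈ S, ∑ t, (h (c * z) t - n ^ 2 / q) ^ 2 :=
          Finset.sum_le_sum fun z _ => Finset.sum_le_sum_of_subset_of_nonneg
            (Finset.subset_univ _) fun _ _ _ => sq_nonneg _
      _ = ∑ l ∈ S.image (c * ·), ∑ t, (h l t - n ^ 2 / q) ^ 2 :=
          (Finset.sum_image (f := fun l => ∑ t, (h l t - n ^ 2 / q) ^ 2)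
            fun x _ y _ hxy => mul_left_cancel₀ hc hxy).symm
      _ ≤ _ := Finset.sum_le_sum_of_subset_of_nonneg (Finset.subset_univ _)
            fun _ _ _ => Finset.sum_nonneg fun _ _ => sq_nonneg _
  have hfin : n ^ 4 ≤ q ^ 3 := by
    have h1 := hlow.trans hvar
    have h2 : n * (n * (n ^ 2 / q) ^ 2) = n ^ 2 * (n ^ 4 / q ^ 2) := by field_simp
    rw [h2, mul_comm q] at h1
    have h3 := le_of_mul_le_mul_left h1 (by positivity)
    rw [div_le_iff₀ (by positivity)] at h3
    linarith
  rw [hn, hq] at hfin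
  exact_mod_cast hfin

end FiniteField

/-! ### Quotients of finite fields -/

section QuotientOfFiniteField

variable {F : Type*} [Field F]

theorem index_eq_natCard_units (G : Subgroup Fˣ) : G.index = Nat.card (FieldQuotient G)ˣ := by
  let f : Fˣ →* (FieldQuotient G)ˣ := Units.map (unitsCon G).mk'
  have hf : Function.Surjective f := by
    intro u
    obtain ⟨a, ha⟩ := orb_surjective G (u : FieldQuotient G)
    have ha0 : a ≠ 0 := by
      rintro rfl
      exact u.ne_zero ha.symm
    exact ⟨Units.mk0 a ha0, Units.ext ha⟩
  have hker : f.ker = G := by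
    ext g
    rw [MonoidHom.mem_ker, Units.ext_iff]
    change orb G (g : F) = orb G 1 ↔ _
    rw [eq_comm, orb_eq]
    constructor
    · rintro ⟨g', hg', h⟩
      rw [one_mul] at h
      rwa [Units.ext h]
    · exact fun hg => ⟨g, hg, (one_mul _).symm⟩
  have hidx : G.index = f.ker.index := by rw [hker]
  rw [hidx, Subgroup.index_ker, MonoidHom.range_eq_top.2 hf]
  exact Nat.card_congr Subgroup.topEquiv.toEquiv

theorem orb_neg_one_eq_orb_one {G : Subgroup Fˣ} [Finite (FieldQuotient G)]
    (h : Odd (Nat.card (FieldQuotient G)ˣ)) : orb G (-1 : F) = orb G 1 := by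
  have h1 := Hyperfield.zero_mem_one_hadd_one h
  refine (Hyperfield.existsUnique_neg (1 : FieldQuotient G)).unique ?_ h1
  exact ⟨1, -1, rfl, rfl, by rw [add_neg_cancel]; rfl⟩

/-- A relation `g + c * g' = g''` in `G` displays `c` as `g'' / g' - g / g'`. If none exists, the
second moment bound gives `|G| ^ 4 ≤ q ^ 3`; combined with `q ≤ 2 * |G| * r`, where `r` is the
index, this forces `q ≤ 16 * r ^ 4`. -/
theorem orb_mem_orbAdd_one_one_of_finite [Finite F] {G : Subgroup Fˣ}
    (h : orb G (-1 : F) = orb G 1) (hcard : 16 * G.index ^ 4 < Nat.card F) {c : F} (hc : c ≠ 0) :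
    orb G c ∈ orbAdd G (orb G 1) (orb G 1) := by
  classical
  by_contra hcon
  have := Fintype.ofFinite F
  let S : Finset F := Finset.univ.filter fun x => ∃ g ∈ G, (g : F) = x
  have hS : ∀ x, x ∈ S ↔ ∃ g ∈ G, (g : F) = x := fun x => by simp [S]
  have hcardS : S.card = Nat.card G := by
    rw [← Fintype.card_coe, ← Nat.card_eq_fintype_card]
    refine (Nat.card_congr (Equiv.ofBijective
      (fun g : G => (⟨((g : Fˣ) : F), (hS _).2 ⟨g, g.2, rfl⟩⟩ : S)) ⟨?_, ?_⟩)).symm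
    · intro g g' hgg
      exact Subtype.ext (Units.ext (congrArg Subtype.val hgg))
    · rintro ⟨x, hx⟩
      obtain ⟨g, hg, rfl⟩ := (hS x).1 hx
      exact ⟨⟨g, hg⟩, rfl⟩
  have key := card_pow_four_le_of_add_mul_notMem S
    (by intro x hx; obtain ⟨g, -, rfl⟩ := (hS x).1 hx; exact g.ne_zero)
    (by
      intro x hx y hy
      obtain ⟨g, hg, rfl⟩ := (hS x).1 hx
      obtain ⟨g', hg', rfl⟩ := (hS y).1 hy
      exact (hS _).2 ⟨g * g', G.mul_mem hg hg', rfl⟩) hc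
    (by
      intro x hx z hz hxz
      obtain ⟨g, hg, rfl⟩ := (hS x).1 hx
      obtain ⟨g', hg', rfl⟩ := (hS z).1 hz
      obtain ⟨g'', hg'', hgg⟩ := (hS _).1 hxz
      refine hcon ⟨((g'' * g'⁻¹ : Fˣ) : F), -((g * g'⁻¹ : Fˣ) : F), ?_, ?_, ?_⟩
      · exact (orb_eq.2 ⟨_, G.mul_mem hg'' (G.inv_mem hg'), (one_mul _).symm⟩).symm
      · rw [orb_neg h]
        exact (orb_eq.2 ⟨_, G.mul_mem hg (G.inv_mem hg'), (one_mul _).symm⟩).symm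
      · congr 1
        push_cast
        rw [hgg]
        field_simp
        ring)
  rw [hcardS, ← Nat.card_eq_fintype_card] at key
  have h1 : Nat.card G * G.index = Nat.card F - 1 := by
    rw [Subgroup.card_mul_index, Nat.card_units]
  set q := Nat.card F
  set n := Nat.card G
  set r := G.index
  have hq2 : 2 ≤ q := Finite.one_lt_card
  have h2 : q ≤ 2 * (n * r) := by omega
  have h3 : q ^ 4 ≤ 16 * r ^ 4 * q ^ 3 := by
    calc q ^ 4 ≤ (2 * (n * r)) ^ 4 := Nat.pow_le_pow_left h2 4
      _ = 16 * r ^ 4 * n ^ 4 := by ring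
      _ ≤ _ := Nat.mul_le_mul_left _ key
  have h4 : q * q ^ 3 ≤ 16 * r ^ 4 * q ^ 3 := by rwa [← pow_succ']
  exact absurd (Nat.le_of_mul_le_mul_right h4 (by positivity)) (by omega)

/-- In a cyclic group `x ^ n = 1` has at most `n` solutions, and a subgroup of order `n` already
supplies that many. -/
theorem mem_iff_pow_natCard_eq_one {M : Type*} [CommGroup M] [Finite M] [IsCyclic M]
    (G : Subgroup M) (x : M) : x ∈ G ↔ x ^ Nat.card G = 1 := by
  classical
  have := Fintype.ofFinite M
  have hsub : (Finset.univ.filter fun y => y ∈ G) ⊆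
      Finset.univ.filter fun y : M => y ^ Nat.card G = 1 := by
    intro y hy
    simp only [Finset.mem_filter, Finset.mem_univ, true_and] at hy ⊢
    exact congrArg Subtype.val (pow_card_eq_one' (x := (⟨y, hy⟩ : G)))
  have hcard : (Finset.univ.filter fun y => y ∈ G).card = Nat.card G := by
    rw [Nat.card_eq_fintype_card, Fintype.card_subtype]
  have := Finset.eq_of_subset_of_card_le hsub
    (by rw [hcard]; exact IsCyclic.card_pow_eq_one_le Nat.card_pos)
  simpa using Finset.ext_iff.1 this x

/-- A finite field is determined by its size, and a subgroup of its cyclic unit group by its order,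
so any field isomorphism carries `G` to `G'`. -/
theorem hyperfieldIso_of_natCard_eq {F F' : Type*} [Field F] [Field F'] [Finite F] [Finite F']
    (hF : Nat.card F = Nat.card F') {G : Subgroup Fˣ} {G' : Subgroup F'ˣ}
    (hG : G.index = G'.index) : HyperfieldIso (FieldQuotient G) (FieldQuotient G') := by
  have := Fintype.ofFinite F
  have := Fintype.ofFinite F'
  let e : F ≃+* F' := FiniteField.ringEquivOfCardEq (by simpa using hF)
  have hcard : Nat.card G = Nat.card G' := by
    have h1 := Subgroup.card_mul_index G
    have h2 := Subgroup.card_mul_index G'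
    rw [Nat.card_units, hF, ← Nat.card_units, hG, ← h2] at h1
    exact Nat.eq_of_mul_eq_mul_right (Nat.pos_of_ne_zero G'.index_ne_zero_of_finite) h1
  have hmem : ∀ g : Fˣ, g ∈ G ↔ Units.mapEquiv (e : F ≃* F') g ∈ G' := by
    intro g
    rw [mem_iff_pow_natCard_eq_one, mem_iff_pow_natCard_eq_one, hcard, ← map_pow,
      MulEquiv.map_eq_one_iff]
  have hrel : ∀ a b, orb G a = orb G b ↔ orb G' (e a) = orb G' (e b) := by
    intro a b
    rw [orb_eq, orb_eq]
    constructor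
    · rintro ⟨g, hg, rfl⟩
      exact ⟨_, (hmem g).1 hg, map_mul e _ _⟩
    · rintro ⟨g, hg, h⟩
      obtain ⟨g, rfl⟩ := (Units.mapEquiv (e : F ≃* F')).surjective g
      refine ⟨g, (hmem g).2 hg, e.injective ?_⟩
      rw [h, map_mul]; rfl
  let E : FieldQuotient G ≃* FieldQuotient G' := Con.congr (e : F ≃* F') (by
    ext a b
    rw [Con.comap_rel]
    exact ((unitsCon G).eq.symm.trans (hrel a b)).trans (unitsCon G').eq)
  have hE : ∀ a, E (orb G a) = orb G' (e a) := fun a => rfl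
  refine ⟨E, fun x y => ?_⟩
  ext z
  constructor
  · rintro ⟨_, ⟨a, b, rfl, rfl, rfl⟩, rfl⟩
    exact ⟨e a, e b, rfl, rfl, by rw [hE, map_add]⟩
  · rintro ⟨a, b, ha, hb, rfl⟩
    obtain ⟨a, rfl⟩ := e.surjective a
    obtain ⟨b, rfl⟩ := e.surjective b
    exact ⟨orb G (a + b), ⟨a, b, E.injective ha, E.injective hb, rfl⟩, by rw [hE, map_add]⟩

end QuotientOfFiniteField

/-- A quotient hyperfield of order `r + 1`, with `r` odd, satisfies `1 + 1 = H` or comes from a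
small finite field. -/
theorem IsQuotientHyperfield.hadd_one_one_eq_univ_or {X : Type*} [Hyperfield X] {r : ℕ}
    (hr : Odd r) (hX : Nat.card X = r + 1) (h : IsQuotientHyperfield.{u} X) :
    Hyperfield.hadd (1 : X) 1 = Set.univ ∨
      ∃ (F : Type u) (_ : Field F) (_ : Finite F) (G : Subgroup Fˣ),
        Nat.card F ≤ 16 * r ^ 4 ∧ G.index = r ∧ HyperfieldIso X (FieldQuotient G) := by
  obtain ⟨F, _, G, hiso⟩ := h
  obtain ⟨e, he⟩ := id hiso
  have hQ : Nat.card (FieldQuotient G) = r + 1 := by rw [← hX]; exact (Nat.card_congr e.toEquiv).symm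
  have hfin : Finite (FieldQuotient G) := Nat.finite_of_card_ne_zero (by omega)
  have hu : Nat.card (FieldQuotient G)ˣ = r := by
    have := Hyperfield.natCard_units_add_one (FieldQuotient G)
    omega
  have hindex : G.index = r := by rw [index_eq_natCard_units, hu]
  have hneg : orb G (-1 : F) = orb G 1 := orb_neg_one_eq_orb_one (hu.symm ▸ hr)
  have huniv : (∀ c : F, c ≠ 0 → orb G c ∈ orbAdd G (orb G 1) (orb G 1)) →
      Hyperfield.hadd (1 : X) 1 = Set.univ := by
    intro hall
    rw [Set.eq_univ_iff_forall]
    intro x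
    rw [← e.injective.mem_set_image, he, map_one]
    obtain ⟨c, hc⟩ := orb_surjective G (e x)
    rw [← hc]
    by_cases h0 : c = 0
    · rw [h0]
      exact ⟨1, -1, rfl, hneg, by rw [add_neg_cancel]⟩
    · exact hall c h0
  rcases finite_or_infinite F with hF | hF
  · rcases lt_or_ge (16 * r ^ 4) (Nat.card F) with h1 | h1
    · exact Or.inl (huniv fun c hc =>
        orb_mem_orbAdd_one_one_of_finite hneg (by rwa [hindex]) hc)
    · exact Or.inr ⟨F, _, hF, G, h1, hindex, hiso⟩
  · exact Or.inl (huniv fun c hc => orb_mem_orbAdd_one_one_of_infinite hneg hc)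

/-! ### Counting Boolean functions under local constraints -/

section Counting

variable {ι Ω : Type*} [Fintype Ω] [DecidableEq Ω]

/-- The Boolean functions that are never true at both ends of `n` disjoint pairs make up at most a
proportion `(3 / 4) ^ n` of all Boolean functions. -/
theorem card_filter_not_and_le [DecidableEq ι] (φ ψ : ι → Ω) (X : Finset ι)
    (hX : ∀ x ∈ X, ∀ y ∈ X, x ≠ y → φ x ≠ φ y ∧ φ x ≠ ψ y ∧ ψ x ≠ ψ y) :
    4 ^ X.card * (Finset.univ.filter fun f : Ω → Bool =>
      ∀ x ∈ X, ¬(f (φ x) = true ∧ f (ψ x) = true)).card ≤ 3 ^ X.card * 2 ^ Fintype.card Ω := by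
  induction X using Finset.induction_on with
  | empty => simp
  | insert x X hx ih =>
    have ih := ih fun y hy z hz => hX y (Finset.mem_insert_of_mem hy) z (Finset.mem_insert_of_mem hz)
    set A := Finset.univ.filter fun f : Ω → Bool =>
      ∀ y ∈ X, ¬(f (φ y) = true ∧ f (ψ y) = true) with hA
    set B := A.filter fun f => f (φ x) = true ∧ f (ψ x) = true with hB
    have hnew : (Finset.univ.filter fun f : Ω → Bool =>
        ∀ y ∈ insert x X, ¬(f (φ y) = true ∧ f (ψ y) = true)) =
        A.filter fun f => ¬(f (φ x) = true ∧ f (ψ x) = true) := by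
      ext f
      simp only [hA, Finset.mem_filter, Finset.mem_univ, true_and, Finset.forall_mem_insert]
      exact and_comm
    -- Setting both ends of the new pair to true preserves the constraints at the other, disjoint
    -- pairs, and is at most four-to-one. So at least a quarter of `A` violates the new constraint.
    -- The two ends may coincide.
    let up : (Ω → Bool) → (Ω → Bool) := fun f => Function.update (Function.update f (φ x) true) (ψ x) true
    have hup : ∀ f ω, ω ≠ φ x → ω ≠ ψ x → up f ω = f ω := by
      intro f ω h1 h2
      simp only [up]
      rw [Function.update_of_ne h2, Function.update_of_ne h1]
    have himg : A.image up ⊆ B := by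
      intro f hf
      obtain ⟨f, hfA, rfl⟩ := Finset.mem_image.1 hf
      have hfA := (Finset.mem_filter.1 hfA).2
      refine Finset.mem_filter.2 ⟨Finset.mem_filter.2 ⟨Finset.mem_univ _, fun y hy => ?_⟩, ?_, ?_⟩
      · have hxy : y ≠ x := fun h => hx (h ▸ hy)
        obtain ⟨h1, h2, h3⟩ := hX y (Finset.mem_insert_of_mem hy) x (Finset.mem_insert_self x X) hxy
        obtain ⟨-, h4, -⟩ := hX x (Finset.mem_insert_self x X) y (Finset.mem_insert_of_mem hy)
          hxy.symm
        rw [hup _ _ h1 h2, hup _ _ h4.symm h3]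
        exact hfA y hy
      · by_cases h : φ x = ψ x
        · simp [up, h]
        · simp only [up]
          rw [Function.update_of_ne h, Function.update_self]
      · simp [up]
    have hfour : A.card ≤ 4 * (A.image up).card := by
      refine Finset.card_le_mul_card_image A 4 fun b _ => ?_
      have : Fintype.card (Bool × Bool) = 4 := rfl
      rw [← this, ← Finset.card_univ]
      refine Finset.card_le_card_of_injOn (fun f => (f (φ x), f (ψ x)))
        (fun _ _ => Finset.mem_coe.2 (Finset.mem_univ _)) ?_
      intro f hf f' hf' hff
      have hf := (Finset.mem_filter.1 (Finset.mem_coe.1 hf)).2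
      have hf' := (Finset.mem_filter.1 (Finset.mem_coe.1 hf')).2
      funext ω
      by_cases h1 : ω = φ x
      · rw [h1]; exact congrArg Prod.fst hff
      by_cases h2 : ω = ψ x
      · rw [h2]; exact congrArg Prod.snd hff
      rw [← hup f ω h1 h2, ← hup f' ω h1 h2, hf, hf']
    have hAB : A.card ≤ 4 * B.card := hfour.trans (Nat.mul_le_mul_left 4 (Finset.card_le_card himg))
    have hsplit := Finset.card_filter_add_card_filter_not (s := A)
      (fun f => f (φ x) = true ∧ f (ψ x) = true)
    rw [hnew, Finset.card_insert_of_notMem hx]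
    set C := (A.filter fun f => ¬(f (φ x) = true ∧ f (ψ x) = true)).card
    have h4C : 4 * C ≤ 3 * A.card := by
      have : B.card + C = A.card := hsplit
      omega
    calc 4 ^ (X.card + 1) * C = 4 ^ X.card * (4 * C) := by ring
      _ ≤ 4 ^ X.card * (3 * A.card) := Nat.mul_le_mul_left _ h4C
      _ = 3 * (4 ^ X.card * A.card) := by ring
      _ ≤ 3 * (3 ^ X.card * 2 ^ Fintype.card Ω) := Nat.mul_le_mul_left _ ih
      _ = _ := by ring

omit [Fintype Ω] in
-- Greedy choice: the pair of a selected index has at most two points, each lying in at most `2 * k`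
-- of the pairs, so each selection discards at most `4 * k` indices.
theorem exists_subset_disjoint_pairs [DecidableEq ι] (φ ψ : ι → Ω) (k : ℕ) (X : Finset ι)
    (hφ : ∀ ω, (X.filter fun x => φ x = ω).card ≤ k)
    (hψ : ∀ ω, (X.filter fun x => ψ x = ω).card ≤ k) :
    ∃ Y ⊆ X, X.card ≤ 4 * k * Y.card ∧
      ∀ x ∈ Y, ∀ y ∈ Y, x ≠ y → φ x ≠ φ y ∧ φ x ≠ ψ y ∧ ψ x ≠ ψ y := by
  induction X using Finset.strongInduction with
  | H X ih =>
    rcases X.eq_empty_or_nonempty with rfl | ⟨x, hx⟩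
    · exact ⟨∅, by simp⟩
    let p : ι → Prop := fun y => (φ y = φ x ∨ φ y = ψ x) ∨ (ψ y = φ x ∨ ψ y = ψ x)
    let Z := X.filter fun y => ¬p y
    have hxZ : x ∉ Z := fun h => (Finset.mem_filter.1 h).2 (Or.inl (Or.inl rfl))
    have hZX : Z ⊂ X := Finset.ssubset_iff_subset_ne.2
      ⟨Finset.filter_subset _ _, fun h => hxZ (h ▸ hx)⟩
    have hmono : ∀ q : ι → Prop, [DecidablePred q] → (Z.filter q).card ≤ (X.filter q).card :=
      fun q _ => Finset.card_le_card (Finset.filter_subset_filter q hZX.1)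
    obtain ⟨Y, hYZ, hcard, hY⟩ := ih Z hZX (fun ω => (hmono _).trans (hφ ω))
      (fun ω => (hmono _).trans (hψ ω))
    refine ⟨insert x Y, ?_, ?_, ?_⟩
    · exact Finset.insert_subset hx (hYZ.trans hZX.1)
    · rw [Finset.card_insert_of_notMem fun h => hxZ (hYZ h)]
      have h1 : (X.filter p).card + Z.card = X.card := Finset.card_filter_add_card_filter_not p
      have h2 : (X.filter p).card ≤ (k + k) + (k + k) := by
        simp only [p, Finset.filter_or]
        exact (Finset.card_union_le _ _).trans (Nat.add_le_add
          ((Finset.card_union_le _ _).trans (Nat.add_le_add (hφ _) (hφ _)))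
          ((Finset.card_union_le _ _).trans (Nat.add_le_add (hψ _) (hψ _))))
      calc X.card ≤ 4 * k + 4 * k * Y.card := by omega
        _ = _ := by ring
    · have hZ : ∀ y ∈ Y, ¬p y := fun y hy => (Finset.mem_filter.1 (hYZ hy)).2
      intro y hy z hz hyz
      rcases Finset.mem_insert.1 hy with rfl | hy <;> rcases Finset.mem_insert.1 hz with rfl | hz
      · exact absurd rfl hyz
      · have := hZ z ‹_›
        simp only [p, not_or] at this
        exact ⟨Ne.symm this.1.1, Ne.symm this.2.1, Ne.symm this.2.2⟩
      · have := hZ y ‹_›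
        simp only [p, not_or] at this
        exact ⟨this.1.1, this.1.2, this.2.2⟩
      · exact hY y ‹_› z ‹_› hyz

/-- Overwriting a function that is true on `I` by arbitrary values on `I` loses no information. -/
theorem card_filter_forall_mem_mul_two_pow_le (I : Finset Ω) :
    (Finset.univ.filter fun f : Ω → Bool => ∀ ω ∈ I, f ω = true).card * 2 ^ I.card ≤
      2 ^ Fintype.card Ω := by
  have h : Fintype.card ({f : Ω → Bool // ∀ ω ∈ I, f ω = true} × (I → Bool)) ≤
      Fintype.card (Ω → Bool) := by
    refine Fintype.card_le_of_injective
      (fun p ω => if h : ω ∈ I then p.2 ⟨ω, h⟩ else p.1.1 ω) ?_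
    rintro ⟨⟨f, hf⟩, g⟩ ⟨⟨f', hf'⟩, g'⟩ h
    refine Prod.ext (Subtype.ext (funext fun ω => ?_)) (funext fun ω => ?_)
    · by_cases hω : ω ∈ I
      · exact (hf ω hω).trans (hf' ω hω).symm
      · simpa [hω] using congrFun h ω
    · simpa using congrFun h ω.1
  simpa [Fintype.card_subtype] using h

end Counting

/-! ### Triple classes, random relations and richness -/

section Triples

variable (G : Type*) [CommGroup G]

/-- Triples up to permutation and scaling. -/
def tripleSetoid : Setoid (G × G × G) where
  r s t := ∃ g : G, ({t.1, t.2.1, t.2.2} : Multiset G) =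
    ({s.1, s.2.1, s.2.2} : Multiset G).map (g * ·)
  iseqv :=
    { refl := fun s => ⟨1, by simp⟩
      symm := by
        rintro s t ⟨g, h⟩
        exact ⟨g⁻¹, by rw [h, Multiset.map_map]; simp⟩
      trans := by
        rintro s t w ⟨g, h⟩ ⟨g', h'⟩
        exact ⟨g' * g, by rw [h', h, Multiset.map_map]; simp [mul_assoc]⟩ }

/-- Unordered triples of elements of `G` up to scaling. -/
abbrev TripleClass : Type _ := Quotient (tripleSetoid G)

variable {G}

/-- The class of a triple. -/
def tripleMk (a b c : G) : TripleClass G := Quotient.mk (tripleSetoid G) (a, b, c)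

theorem tripleMk_eq {a b c a' b' c' : G} : tripleMk a b c = tripleMk a' b' c' ↔
    ∃ g : G, ({a', b', c'} : Multiset G) = ({a, b, c} : Multiset G).map (g * ·) :=
  Quotient.eq (r := tripleSetoid G)

theorem tripleMk_swap (a b c : G) : tripleMk a b c = tripleMk b a c := by
  refine tripleMk_eq.2 ⟨1, ?_⟩
  simp only [one_mul, Multiset.map_id', Multiset.insert_eq_cons]
  exact Multiset.cons_swap _ _ _

theorem tripleMk_rotate (a b c : G) : tripleMk a b c = tripleMk a c b := by
  refine tripleMk_eq.2 ⟨1, ?_⟩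
  simp only [one_mul, Multiset.map_id', Multiset.insert_eq_cons]
  exact congrArg (a ::ₘ ·) (Multiset.cons_swap c b 0)

theorem tripleMk_scale (g a b c : G) : tripleMk (g * a) (g * b) (g * c) = tripleMk a b c :=
  (tripleMk_eq.2 ⟨g, by simp⟩).symm

/-- A scaling of `{u, v, w}` onto `{a, b, x}` sends one of `u`, `v`, `w` to `a`, which leaves three
scalars; comparing products then determines `x`. -/
theorem card_filter_tripleMk_le [Fintype G] [DecidableEq G] [DecidableEq (TripleClass G)] (a b : G)
    (ω : TripleClass G) : (Finset.univ.filter fun x => tripleMk a b x = ω).card ≤ 3 := by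
  obtain ⟨⟨u, v, w⟩, rfl⟩ := Quotient.exists_rep ω
  have : (Finset.univ.filter fun x => tripleMk a b x = tripleMk u v w) ⊆
      ({a * u⁻¹, a * v⁻¹, a * w⁻¹} : Finset G).image
        fun g => (a * b)⁻¹ * ((g * u) * ((g * v) * (g * w))) := by
    intro x hx
    obtain ⟨g, hg⟩ := tripleMk_eq.1 (Finset.mem_filter.1 hx).2.symm
    have hprod := congrArg Multiset.prod hg
    have ha : a ∈ Multiset.map (g * ·) ({u, v, w} : Multiset G) := by
      rw [← hg]; simp
    simp only [Multiset.insert_eq_cons, Multiset.map_cons, Multiset.map_singleton,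
      Multiset.prod_cons, Multiset.prod_singleton, Multiset.mem_cons,
      Multiset.mem_singleton] at hprod ha
    refine Finset.mem_image.2 ⟨g, ?_, ?_⟩
    · rcases ha with rfl | rfl | rfl <;> simp
    · rw [← hprod]
      group
  exact (Finset.card_le_card this).trans (Finset.card_image_le.trans Finset.card_le_three)

/-- The ternary relation of a Boolean function on classes of triples. -/
def tripleRel (f : TripleClass G → Bool) (a b c : G) : Prop := f (tripleMk a b c) = true

theorem isRichRelation_tripleRel {f : TripleClass G → Bool}
    (hf : ∀ a b c d : G, ∃ x, f (tripleMk a b x) = true ∧ f (tripleMk c d x) = true) :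
    IsRichRelation (tripleRel f) where
  swap a b c h := by rwa [tripleRel, tripleMk_swap]
  rotate a b c h := by rwa [tripleRel, tripleMk_rotate]
  scale g a b c h := by rwa [tripleRel, tripleMk_scale]
  rich := hf

/-- Union bound over the `r ^ 4` quadruples. For each of them `r / 12` values of `x` give disjoint
pairs of classes (`12 = 4 * 3`, from the greedy choice with fibres of size at most three), so
richness fails there for a proportion at most `(3 / 4) ^ (r / 12)`. The hypothesis makes the total
at most one half. -/
theorem two_pow_le_two_mul_card_rich [Fintype G] [Fintype (TripleClass G)]
    [DecidableEq (TripleClass G)] [DecidableEq G]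
    (hG : 2 * Fintype.card G ^ 4 * 3 ^ (Fintype.card G / 12) ≤ 4 ^ (Fintype.card G / 12)) :
    2 ^ Fintype.card (TripleClass G) ≤ 2 * (Finset.univ.filter fun f : TripleClass G → Bool =>
      ∀ a b c d : G, ∃ x, f (tripleMk a b x) = true ∧ f (tripleMk c d x) = true).card := by
  set r := Fintype.card G
  set m := r / 12
  let bad : G × G × G × G → Finset (TripleClass G → Bool) := fun p => Finset.univ.filter fun f =>
    ∀ x, ¬(f (tripleMk p.1 p.2.1 x) = true ∧ f (tripleMk p.2.2.1 p.2.2.2 x) = true)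
  have hbad : ∀ p, 4 ^ m * (bad p).card ≤ 3 ^ m * 2 ^ Fintype.card (TripleClass G) := by
    intro p
    obtain ⟨Y, -, hY, hYd⟩ := exists_subset_disjoint_pairs (tripleMk p.1 p.2.1)
      (tripleMk p.2.2.1 p.2.2.2) 3 Finset.univ (card_filter_tripleMk_le _ _)
      (card_filter_tripleMk_le _ _)
    rw [Finset.card_univ] at hY
    obtain ⟨Z, hZY, hZ⟩ := Finset.exists_subset_card_eq (s := Y) (n := m) (by omega)
    have := card_filter_not_and_le (tripleMk p.1 p.2.1) (tripleMk p.2.2.1 p.2.2.2) Z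
      fun x hx y hy => hYd x (hZY hx) y (hZY hy)
    rw [hZ] at this
    refine le_trans (Nat.mul_le_mul_left _ (Finset.card_le_card fun f hf => ?_)) this
    simp only [bad, Finset.mem_filter, Finset.mem_univ, true_and] at hf ⊢
    exact fun x _ => hf x
  set good := Finset.univ.filter fun f : TripleClass G → Bool =>
      ∀ a b c d : G, ∃ x, f (tripleMk a b x) = true ∧ f (tripleMk c d x) = true
  have hcover : (Finset.univ : Finset (TripleClass G → Bool)) ⊆ good ∪ Finset.univ.biUnion bad := by
    intro f _
    by_cases hf : f ∈ good
    · exact Finset.mem_union_left _ hf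
    · simp only [good, Finset.mem_filter, Finset.mem_univ, true_and, not_forall, not_exists] at hf
      obtain ⟨a, b, c, d, h⟩ := hf
      exact Finset.mem_union_right _ (Finset.mem_biUnion.2 ⟨(a, b, c, d), Finset.mem_univ _,
        Finset.mem_filter.2 ⟨Finset.mem_univ _, h⟩⟩)
  have h1 : 2 ^ Fintype.card (TripleClass G) ≤ good.card + ∑ p, (bad p).card := by
    have := (Finset.card_le_card hcover).trans (Finset.card_union_le _ _)
    rw [Finset.card_univ, Fintype.card_fun, Fintype.card_bool] at this
    exact this.trans (Nat.add_le_add_left Finset.card_biUnion_le _)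
  have h2 : 4 ^ m * ∑ p, (bad p).card ≤ r ^ 4 * (3 ^ m * 2 ^ Fintype.card (TripleClass G)) := by
    rw [Finset.mul_sum]
    refine (Finset.sum_le_sum fun p _ => hbad p).trans (le_of_eq ?_)
    rw [Finset.sum_const, Finset.card_univ, smul_eq_mul]
    simp only [Fintype.card_prod]
    ring
  set N := 2 ^ Fintype.card (TripleClass G)
  set s := ∑ p, (bad p).card
  have h3 : 4 ^ m * (2 * s) ≤ 4 ^ m * N := by
    calc 4 ^ m * (2 * s) = 2 * (4 ^ m * s) := by ring
      _ ≤ 2 * (r ^ 4 * (3 ^ m * N)) := Nat.mul_le_mul_left _ h2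
      _ = (2 * r ^ 4 * 3 ^ m) * N := by ring
      _ ≤ _ := Nat.mul_le_mul_right _ hG
  have h4 := Nat.le_of_mul_le_mul_left h3 (by positivity)
  omega

/-- The classes of `(1, 1, x)` number at least `r / 3`, and the function is prescribed on all of
them. -/
theorem card_full_mul_two_pow_le [Fintype G] [Fintype (TripleClass G)]
    [DecidableEq (TripleClass G)] [DecidableEq G] :
    (Finset.univ.filter fun f : TripleClass G → Bool => ∀ x, f (tripleMk 1 1 x) = true).card *
      2 ^ (Fintype.card G / 3) ≤ 2 ^ Fintype.card (TripleClass G) := by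
  let I : Finset (TripleClass G) := Finset.univ.image (tripleMk (1 : G) 1)
  have hI : Fintype.card G ≤ 3 * I.card :=
    Finset.card_le_mul_card_image (f := tripleMk (1 : G) 1) Finset.univ 3 fun ω _ => card_filter_tripleMk_le 1 1 ω
  refine le_trans (Nat.mul_le_mul (Finset.card_le_card ?_) ?_) (card_filter_forall_mem_mul_two_pow_le I)
  · intro f hf
    refine Finset.mem_filter.2 ⟨Finset.mem_univ _, fun ω hω => ?_⟩
    obtain ⟨x, -, rfl⟩ := Finset.mem_image.1 hω
    exact (Finset.mem_filter.1 hf).2 x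
  · exact Nat.pow_le_pow_right (by norm_num) (by omega)

end Triples

/-! ### Few automorphisms -/

section Automorphisms

/-- By Lagrange, adding an element outside a subgroup at least doubles it; a largest set `S` for
which `2 ^ S.card` is at most the order of its closure must therefore generate. -/
theorem exists_closure_eq_top_two_pow_card_le (G : Type*) [Group G] [Finite G] :
    ∃ S : Finset G, Subgroup.closure (S : Set G) = ⊤ ∧ 2 ^ S.card ≤ Nat.card G := by
  classical
  have := Fintype.ofFinite G
  let good := Finset.univ.filter fun S : Finset G =>
    2 ^ S.card ≤ Nat.card (Subgroup.closure (S : Set G))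
  have hne : good.Nonempty := ⟨∅, by simp [good]⟩
  obtain ⟨S, hS, hmax⟩ := good.exists_max_image Finset.card hne
  have hS := (Finset.mem_filter.1 hS).2
  refine ⟨S, ?_, hS.trans (Subgroup.card_le_card_group _)⟩
  by_contra htop
  obtain ⟨x, hx⟩ : ∃ x, x ∉ Subgroup.closure (S : Set G) := by
    by_contra h
    push Not at h
    exact htop (Subgroup.eq_top_iff' _ |>.2 h)
  have hxS : x ∉ S := fun h => hx (Subgroup.subset_closure h)
  have hlt : Subgroup.closure (S : Set G) < Subgroup.closure ((insert x S : Finset G) : Set G) := by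
    refine lt_of_le_of_ne (Subgroup.closure_mono (by simp)) fun h => hx ?_
    rw [h]
    exact Subgroup.subset_closure (by simp)
  have hdvd := Subgroup.card_dvd_of_le hlt.le
  have hcard : Nat.card (Subgroup.closure (S : Set G)) <
      Nat.card (Subgroup.closure ((insert x S : Finset G) : Set G)) :=
    lt_of_le_of_ne (Nat.le_of_dvd Nat.card_pos hdvd)
      fun h => hlt.ne (Subgroup.eq_of_le_of_card_ge hlt.le h.ge)
  obtain ⟨k, hk⟩ := hdvd
  have hk2 : 2 ≤ k := by
    by_contra hk2
    have : k = 0 ∨ k = 1 := by omega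
    rcases this with rfl | rfl <;> omega
  have hbig : insert x S ∈ good := by
    refine Finset.mem_filter.2 ⟨Finset.mem_univ _, ?_⟩
    rw [Finset.card_insert_of_notMem hxS, hk, pow_succ]
    exact Nat.mul_le_mul hS hk2
  have := hmax _ hbig
  rw [Finset.card_insert_of_notMem hxS] at this
  omega

theorem natCard_mulAut_withZero_le (G : Type*) [Group G] [Finite G] :
    Nat.card (MulAut (WithZero G)) ≤ (Nat.card G + 1) ^ Nat.log 2 (Nat.card G) := by
  classical
  obtain ⟨S, hS, hcard⟩ := exists_closure_eq_top_two_pow_card_le G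
  have hfin : Finite (WithZero G) := inferInstanceAs (Finite (Option G))
  have hW : Nat.card (WithZero G) = Nat.card G + 1 := Finite.card_option (α := G)
  let res : MulAut (WithZero G) → (S → WithZero G) := fun α s => α ((s : G) : WithZero G)
  have hinj : Function.Injective res := by
    intro α β h
    have : α.toMonoidHom.comp (WithZero.coeMonoidHom (α := G)) =
        β.toMonoidHom.comp (WithZero.coeMonoidHom (α := G)) :=
      MonoidHom.eq_of_eqOn_dense hS fun s hs => congrFun h ⟨s, hs⟩
    ext x
    induction x with
    | zero => rw [map_zero, map_zero]
    | coe g => exact DFunLike.congr_fun this g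
  refine (Nat.card_le_card_of_injective res hinj).trans ?_
  rw [Nat.card_fun, hW, Nat.card_eq_fintype_card (α := S), Fintype.card_coe]
  exact Nat.pow_le_pow_right (by omega) (Nat.le_log_of_pow_le (by norm_num) hcard)

end Automorphisms

/-! ### Isomorphism classes and their finiteness -/

section Classes

/-- A representative of an isomorphism class of hyperfields. -/
noncomputable abbrev HyperfieldClass.Rep {n : ℕ} (c : HyperfieldClass n) : Type := c.out.carrier

theorem HyperfieldClass.eq_of_iso {n : ℕ} {c d : HyperfieldClass n}
    (h : HyperfieldIso c.Rep d.Rep) : c = d := by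
  rw [← Quotient.out_eq c, ← Quotient.out_eq d]
  exact Quotient.sound h

theorem HyperfieldOfOrder.iso_rep {n : ℕ} (X : HyperfieldOfOrder n) :
    HyperfieldIso X.carrier (HyperfieldClass.Rep ⟦X⟧) :=
  HyperfieldIso.symm (Quotient.mk_out X)

theorem HyperfieldOfOrder.finite {n : ℕ} (X : HyperfieldOfOrder (n + 1)) : Finite X.carrier :=
  Nat.finite_of_card_ne_zero (by rw [X.card_eq]; omega)

theorem HyperfieldOfOrder.natCard_units {n : ℕ} (X : HyperfieldOfOrder (n + 1)) :
    Nat.card X.carrierˣ = n := by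
  have := X.finite
  have h := Hyperfield.natCard_units_add_one X.carrier
  rw [X.card_eq] at h
  omega

theorem HyperfieldOfOrder.zero_mem_one_hadd_one {r : ℕ} (hr : Odd r)
    (X : HyperfieldOfOrder (r + 1)) : (0 : X.carrier) ∈ Hyperfield.hadd (1 : X.carrier) 1 := by
  have := X.finite
  exact Hyperfield.zero_mem_one_hadd_one (X.natCard_units.symm ▸ hr)

instance finite_hyperfieldClass (n : ℕ) : Finite (HyperfieldClass (n + 1)) := by
  have e : ∀ c : HyperfieldClass (n + 1), Nonempty (c.Rep ≃ Fin (n + 1)) := fun c =>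
    have := c.out.finite
    ⟨Finite.equivFinOfCardEq c.out.card_eq⟩
  replace e := fun c => (e c).some
  -- The multiplication and addition tables, transported to `Fin (n + 1)`, determine the class.
  let data : HyperfieldClass (n + 1) →
      (Fin (n + 1) → Fin (n + 1) → Fin (n + 1)) × (Fin (n + 1) → Fin (n + 1) → Set (Fin (n + 1))) :=
    fun c => (fun i j => e c ((e c).symm i * (e c).symm j),
      fun i j => e c '' Hyperfield.hadd ((e c).symm i) ((e c).symm j))
  refine Finite.of_injective data fun c d h => HyperfieldClass.eq_of_iso ?_
  have hmul := fun i j => congrFun (congrFun (congrArg Prod.fst h) i) j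
  have hadd := fun i j => congrFun (congrFun (congrArg Prod.snd h) i) j
  simp only [data] at hmul hadd
  refine ⟨⟨(e c).trans (e d).symm, fun a b => ?_⟩, fun a b => ?_⟩
  · have := hmul (e c a) (e c b)
    simp only [Equiv.symm_apply_apply] at this
    simp [this]
  · have := hadd (e c a) (e c b)
    simp only [Equiv.symm_apply_apply] at this
    change (fun x => (e d).symm (e c x)) '' _ = Hyperfield.hadd ((e d).symm (e c a)) ((e d).symm (e c b))
    rw [← Set.image_image (e d).symm (e c), this, Set.image_image]
    simp

end Classes

/-! ### Many hyperfields over a given multiplicative group -/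

section LowerBound

variable {G : Type} [CommGroup G]

/-- The hyperfield of a rich relation on a group with `r` elements, as a hyperfield of order
`r + 1`. -/
@[reducible] noncomputable def IsRichRelation.hyperfieldOfOrder [Finite G] {r : ℕ} (hG : Nat.card G = r)
    {T : G → G → G → Prop} (h : IsRichRelation T) : HyperfieldOfOrder (r + 1) where
  carrier := WithZero G
  str := h.hyperfield
  card_eq := (Finite.card_option (α := G)).trans (by rw [hG])

/-- Functions giving the same class as `f₀` are recovered from an automorphism of `WithZero G`
carrying their addition to that of `f₀`, so each fibre is no larger than the automorphism group. -/
theorem card_rich_le [Fintype G] [Fintype (TripleClass G)] [DecidableEq (TripleClass G)] {r : ℕ}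
    (hG : Fintype.card G = r) :
    (Finset.univ.filter fun f : TripleClass G → Bool =>
      ∀ a b c d : G, ∃ x, f (tripleMk a b x) = true ∧ f (tripleMk c d x) = true).card ≤
    (r + 1) ^ Nat.log 2 r *
      {d : HyperfieldClass (r + 1) | Nonempty (WithZero G ≃* d.Rep)}.ncard := by
  classical
  have hG' : Nat.card G = r := by rw [Nat.card_eq_fintype_card, hG]
  have hW : Finite (WithZero G) := inferInstanceAs (Finite (Option G))
  have hA : Finite (MulAut (WithZero G)) :=
    Finite.of_injective (fun α : MulAut (WithZero G) => (α : WithZero G → WithZero G))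
      DFunLike.coe_injective
  set good := Finset.univ.filter fun f : TripleClass G → Bool =>
    ∀ a b c d : G, ∃ x, f (tripleMk a b x) = true ∧ f (tripleMk c d x) = true with hgood
  have hrich : ∀ f : good, IsRichRelation (tripleRel f.1) := fun f =>
    isRichRelation_tripleRel (Finset.mem_filter.1 f.2).2
  let cls : good → HyperfieldClass (r + 1) := fun f => ⟦(hrich f).hyperfieldOfOrder hG'⟧
  have hfib : ∀ d ∈ (Finset.univ : Finset good).image cls,
      (Finset.univ.filter fun f => cls f = d).card ≤ Nat.card (MulAut (WithZero G)) := by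
    intro d hd
    obtain ⟨f₀, -, rfl⟩ := Finset.mem_image.1 hd
    have hex : ∀ f : {f : good // cls f = cls f₀}, ∃ α : MulAut (WithZero G), ∀ a b,
        α '' relAdd (tripleRel f.1.1) a b = relAdd (tripleRel f₀.1) (α a) (α b) := fun f => by
      obtain ⟨α, hα⟩ := Quotient.exact (show (⟦(hrich f.1).hyperfieldOfOrder hG'⟧ : HyperfieldClass (r + 1)) =
        ⟦(hrich f₀).hyperfieldOfOrder hG'⟧ from f.2)
      exact ⟨α, hα⟩
    choose α hα using hex
    have hinj : Function.Injective α := by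
      intro f f' hff
      apply Subtype.ext
      apply Subtype.ext
      funext ω
      obtain ⟨⟨a, b, c⟩, rfl⟩ := Quotient.exists_rep ω
      have h1 : relAdd (tripleRel f.1.1) (a : WithZero G) b = relAdd (tripleRel f'.1.1) a b := by
        have := hα f a b
        rw [hff, ← hα f' a b] at this
        exact (α f').injective.image_injective this
      have h2 : tripleRel f.1.1 a b c ↔ tripleRel f'.1.1 a b c := by
        rw [← coe_mem_relAdd (T := tripleRel f.1.1), h1, coe_mem_relAdd]
      exact Bool.eq_iff_iff.2 h2
    rw [← Fintype.card_subtype, ← Nat.card_eq_fintype_card]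
    exact Nat.card_le_card_of_injective α hinj
  have h1 := Finset.card_le_mul_card_image _ _ hfib
  rw [Finset.card_univ, Fintype.card_coe] at h1
  refine h1.trans (Nat.mul_le_mul ?_ ?_)
  · have := natCard_mulAut_withZero_le G
    rwa [hG'] at this
  · rw [← Set.ncard_coe_finset]
    refine Set.ncard_le_ncard ?_ (Set.toFinite _)
    intro d hd
    obtain ⟨f, -, rfl⟩ := Finset.mem_image.1 (Finset.mem_coe.1 hd)
    obtain ⟨e, -⟩ := ((hrich f).hyperfieldOfOrder hG').iso_rep
    exact ⟨e⟩

end LowerBound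

/-! ### Encoding hyperfields as functions on triple classes -/

section UpperBound

theorem rel_of_multiset_eq {α : Type*} {P : α → α → α → Prop} (hs : ∀ a b c, P a b c → P b a c)
    (hr : ∀ a b c, P a b c → P a c b) {a b c a' b' c' : α}
    (h : ({a, b, c} : Multiset α) = {a', b', c'}) (hP : P a b c) : P a' b' c' := by
  have two : ∀ a b c b' c', ({b, c} : Multiset α) = {b', c'} → P a b c → P a b' c' := by
    intro a b c b' c' h hP
    have hb : b' ∈ ({b, c} : Multiset α) := h ▸ Multiset.mem_cons_self _ _
    rcases Multiset.mem_cons.1 hb with rfl | hb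
    · have := (Multiset.cons_inj_right b').1 h
      rwa [← Multiset.singleton_inj.1 this]
    · obtain rfl := Multiset.mem_singleton.1 hb
      have h' : b' ::ₘ {b} = b' ::ₘ {c'} := (Multiset.cons_swap b' b 0).trans h
      rw [← Multiset.singleton_inj.1 ((Multiset.cons_inj_right b').1 h')]
      exact hr _ _ _ hP
  have ha : a' ∈ ({a, b, c} : Multiset α) := h ▸ Multiset.mem_cons_self _ _
  have key : ∀ x y z, ({x, y, z} : Multiset α) = {a', b', c'} → x = a' → P x y z → P a' b' c' := by
    rintro x y z h rfl hP
    exact two _ _ _ _ _ ((Multiset.cons_inj_right x).1 h) hP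
  rcases Multiset.mem_cons.1 ha with h1 | ha
  · exact key a b c h h1.symm hP
  rcases Multiset.mem_cons.1 ha with h1 | ha
  · exact key b a c ((Multiset.cons_swap b a {c}).trans h) h1.symm (hs _ _ _ hP)
  · have h1 := Multiset.mem_singleton.1 ha
    refine key c a b (Eq.trans ?_ h) h1.symm (hs _ _ _ (hr _ _ _ hP))
    exact (Multiset.cons_swap c a {b}).trans (congrArg (a ::ₘ ·) (Multiset.cons_swap c b 0))

variable {G : Type*} [CommGroup G]

/-- The ternary relation on `G` of a hyperfield whose multiplicative monoid is `WithZero G`. -/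
def hyperfieldRel {X : Type*} [Hyperfield X] (e : X ≃* WithZero G) (a b c : G) : Prop :=
  e.symm c ∈ Hyperfield.hadd (e.symm a) (e.symm b)

open Classical in
/-- The relation `hyperfieldRel` as a function on classes of triples. -/
noncomputable def hyperfieldFun {X : Type*} [Hyperfield X] (e : X ≃* WithZero G)
    (ω : TripleClass G) : Bool :=
  decide (hyperfieldRel e ω.out.1 ω.out.2.1 ω.out.2.2)

theorem hyperfieldRel_scale {X : Type*} [Hyperfield X] (e : X ≃* WithZero G) (g a b c : G)
    (h : hyperfieldRel e a b c) : hyperfieldRel e (g * a) (g * b) (g * c) := by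
  simp only [hyperfieldRel, WithZero.coe_mul, map_mul]
  exact Hyperfield.mem_hadd_mul _ h

/-- Permutation symmetry, available since `-1 = 1`, and scaling invariance make the value
independent of the representative chosen by `out`. -/
theorem hyperfieldFun_tripleMk {X : Type*} [Hyperfield X]
    (hX : (0 : X) ∈ Hyperfield.hadd (1 : X) 1) (e : X ≃* WithZero G) (a b c : G) :
    hyperfieldFun e (tripleMk a b c) = true ↔ hyperfieldRel e a b c := by
  have hs : ∀ a b c, hyperfieldRel e a b c → hyperfieldRel e b a c := fun a b c h => by
    rwa [hyperfieldRel, Hyperfield.hadd_comm]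
  have hr : ∀ a b c, hyperfieldRel e a b c → hyperfieldRel e a c b := fun a b c h =>
    Hyperfield.mem_hadd_rotate hX h
  have key : ∀ s t : G × G × G, tripleSetoid G s t → hyperfieldRel e s.1 s.2.1 s.2.2 →
      hyperfieldRel e t.1 t.2.1 t.2.2 := by
    rintro s t ⟨g, hg⟩ h
    refine rel_of_multiset_eq hs hr ?_ (hyperfieldRel_scale e g _ _ _ h)
    rw [hg]
    simp
  have hout : tripleSetoid G (tripleMk a b c).out (a, b, c) := Quotient.mk_out (a, b, c)
  simp only [hyperfieldFun, decide_eq_true_iff]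
  exact ⟨key _ _ hout, key _ _ ((tripleSetoid G).symm hout)⟩

theorem iso_of_hyperfieldFun_eq {X Y : Type*} [Hyperfield X] [Hyperfield Y]
    (hX : (0 : X) ∈ Hyperfield.hadd (1 : X) 1) (hY : (0 : Y) ∈ Hyperfield.hadd (1 : Y) 1)
    (e : X ≃* WithZero G) (e' : Y ≃* WithZero G) (h : hyperfieldFun e = hyperfieldFun e') :
    HyperfieldIso X Y := by
  refine Hyperfield.iso_of_mulEquiv hX hY (e.trans e'.symm) fun a b c ha hb hc => ?_
  have hcoe : ∀ x : X, x ≠ 0 → ∃ g : G, x = e.symm g := by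
    intro x hx
    obtain ⟨g, hg⟩ := WithZero.ne_zero_iff_exists.1
      (fun h0 : e x = 0 => hx (e.injective (h0.trans (map_zero e).symm)))
    exact ⟨g, by rw [hg, e.symm_apply_apply]⟩
  obtain ⟨a, rfl⟩ := hcoe a ha
  obtain ⟨b, rfl⟩ := hcoe b hb
  obtain ⟨c, rfl⟩ := hcoe c hc
  simp only [MulEquiv.trans_apply, MulEquiv.apply_symm_apply]
  change hyperfieldRel e a b c ↔ hyperfieldRel e' a b c
  rw [← hyperfieldFun_tripleMk hX, h, hyperfieldFun_tripleMk hY]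

theorem ncard_full_le [Fintype G] [Fintype (TripleClass G)] [DecidableEq (TripleClass G)] {r : ℕ}
    (hr : Odd r) :
    {d : HyperfieldClass (r + 1) | Nonempty (WithZero G ≃* d.Rep) ∧
      Hyperfield.hadd (1 : d.Rep) 1 = Set.univ}.ncard ≤
    (Finset.univ.filter fun f : TripleClass G → Bool => ∀ x, f (tripleMk 1 1 x) = true).card := by
  classical
  have hX := fun d : HyperfieldClass (r + 1) => d.out.zero_mem_one_hadd_one hr
  rw [← Set.ncard_coe_finset]
  -- The function determines the class. The value in the other branch never matters on the set
  -- considered.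
  refine Set.ncard_le_ncard_of_injOn (fun d => if h : Nonempty (WithZero G ≃* d.Rep) then
    hyperfieldFun h.some.symm else fun _ => true) ?_ ?_ (Set.toFinite _)
  · rintro d ⟨h, huniv⟩
    rw [dif_pos h]
    refine Finset.mem_coe.2 (Finset.mem_filter.2 ⟨Finset.mem_univ _, fun x => ?_⟩)
    rw [hyperfieldFun_tripleMk (hX d), hyperfieldRel, WithZero.coe_one, map_one, huniv]
    trivial
  · rintro d ⟨h, -⟩ d' ⟨h', -⟩ hdd
    dsimp only at hdd
    rw [dif_pos h, dif_pos h'] at hdd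
    exact HyperfieldClass.eq_of_iso (iso_of_hyperfieldFun_eq (hX d) (hX d') _ _ hdd)

end UpperBound

/-! ### Comparing quotient hyperfields with all hyperfields -/

section Ratio

theorem exists_commGroup_natCard_eq {r : ℕ} (hr : 0 < r) :
    ∃ (G : Type) (_ : CommGroup G), Nat.card G = r := by
  have : NeZero r := ⟨hr.ne'⟩
  exact ⟨Multiplicative (ZMod r), inferInstance, by simp⟩

/-- The exponential lower bound for the number of classes with a given multiplicative group. -/
theorem two_pow_card_tripleClass_le {G : Type} [CommGroup G] [Fintype G] [Fintype (TripleClass G)]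
    {r : ℕ} (hG : Fintype.card G = r) (h : 2 * r ^ 4 * 3 ^ (r / 12) ≤ 4 ^ (r / 12)) :
    2 ^ Fintype.card (TripleClass G) ≤ 2 * (r + 1) ^ Nat.log 2 r *
      {d : HyperfieldClass (r + 1) | Nonempty (WithZero G ≃* d.Rep)}.ncard := by
  classical
  have h1 := two_pow_le_two_mul_card_rich (G := G) (by rwa [hG])
  have h2 := card_rich_le (G := G) hG
  rw [mul_assoc]
  exact h1.trans (Nat.mul_le_mul_left 2 h2)

/-- One multiplicative group suffices. This absolute bound absorbs the quotients of small fields. -/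
theorem two_pow_le_natCard_hyperfieldClass {r : ℕ} (hr : 0 < r)
    (h : 2 * r ^ 4 * 3 ^ (r / 12) ≤ 4 ^ (r / 12)) :
    2 ^ (r / 3) ≤ 2 * (r + 1) ^ Nat.log 2 r * Nat.card (HyperfieldClass (r + 1)) := by
  classical
  obtain ⟨G, _, hG⟩ := exists_commGroup_natCard_eq hr
  have : Finite G := Nat.finite_of_card_ne_zero (by omega)
  have := Fintype.ofFinite G
  have : Finite (TripleClass G) := Quotient.finite _
  have := Fintype.ofFinite (TripleClass G)
  rw [Nat.card_eq_fintype_card] at hG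
  have h1 := two_pow_card_tripleClass_le hG h
  have h2 := card_full_mul_two_pow_le (G := G)
  rw [hG] at h2
  have h3 : 0 < (Finset.univ.filter fun f : TripleClass G → Bool =>
      ∀ x, f (tripleMk 1 1 x) = true).card :=
    Finset.card_pos.2 ⟨fun _ => true, Finset.mem_filter.2 ⟨Finset.mem_univ _, fun _ => rfl⟩⟩
  calc 2 ^ (r / 3) ≤ _ := Nat.le_mul_of_pos_left _ h3
    _ ≤ _ := h2
    _ ≤ _ := h1
    _ ≤ _ := Nat.mul_le_mul_left _ (by
      rw [← Set.ncard_univ]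
      exact Set.ncard_le_ncard (Set.subset_univ _) (Set.toFinite _))

/-- Hyperfields with `1 + 1 = H` are rare. -/
theorem ncard_hadd_one_one_eq_univ_mul_le {r : ℕ} (hr : Odd r)
    (h : 2 * r ^ 4 * 3 ^ (r / 12) ≤ 4 ^ (r / 12)) :
    {d : HyperfieldClass (r + 1) | Hyperfield.hadd (1 : d.Rep) 1 = Set.univ}.ncard * 2 ^ (r / 3) ≤
      2 * (r + 1) ^ Nat.log 2 r * Nat.card (HyperfieldClass (r + 1)) := by
  classical
  have := Fintype.ofFinite (HyperfieldClass (r + 1))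
  -- Both counts are split by the multiplicative monoid and compared fibre by fibre, since the
  -- number of triple classes depends on the group.
  let κ : HyperfieldClass (r + 1) → Set (HyperfieldClass (r + 1)) :=
    fun d => {d' | Nonempty (d.Rep ≃* d'.Rep)}
  have hκ : ∀ d d', κ d = κ d' ↔ Nonempty (d'.Rep ≃* d.Rep) := by
    intro d d'
    constructor
    · intro hd
      have : d ∈ κ d := ⟨MulEquiv.refl _⟩
      rw [hd] at this
      exact this
    · rintro ⟨e⟩
      ext c
      exact ⟨fun ⟨e'⟩ => ⟨e.trans e'⟩, fun ⟨e'⟩ => ⟨e.symm.trans e'⟩⟩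
  let A : Finset (HyperfieldClass (r + 1)) :=
    Finset.univ.filter fun d => Hyperfield.hadd (1 : d.Rep) 1 = Set.univ
  have hA : {d : HyperfieldClass (r + 1) | Hyperfield.hadd (1 : d.Rep) 1 = Set.univ}.ncard =
      A.card := by
    rw [← Set.ncard_coe_finset]
    congr 1
    ext d
    simp [A]
  rw [hA, Nat.card_eq_fintype_card, ← Finset.card_univ,
    Finset.card_eq_sum_card_fiberwise (f := κ) (s := A) (t := Finset.univ.image κ)
      (fun d _ => Finset.mem_coe.2 (Finset.mem_image_of_mem _ (Finset.mem_univ _))),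
    Finset.card_eq_sum_card_fiberwise (f := κ) (s := Finset.univ) (t := Finset.univ.image κ)
      (fun d _ => Finset.mem_coe.2 (Finset.mem_image_of_mem _ (Finset.mem_univ _))),
    Finset.sum_mul, Finset.mul_sum]
  refine Finset.sum_le_sum fun K hK => ?_
  obtain ⟨d₀, -, rfl⟩ := Finset.mem_image.1 hK
  let G := d₀.Repˣ
  have hfin : Finite d₀.Rep := d₀.out.finite
  have := Fintype.ofFinite G
  have : Finite (TripleClass G) := Quotient.finite _
  have := Fintype.ofFinite (TripleClass G)
  have hG : Fintype.card G = r := by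
    rw [← Nat.card_eq_fintype_card]
    exact d₀.out.natCard_units
  obtain ⟨e⟩ := Hyperfield.nonempty_mulEquiv_withZero_units d₀.Rep
  have hiff : ∀ d, κ d = κ d₀ ↔ Nonempty (WithZero G ≃* d.Rep) := by
    intro d
    rw [hκ]
    exact ⟨fun ⟨e'⟩ => ⟨e.symm.trans e'⟩, fun ⟨e'⟩ => ⟨e.trans e'⟩⟩
  have h1 := two_pow_card_tripleClass_le hG h
  have h2 := card_full_mul_two_pow_le (G := G)
  rw [hG] at h2
  have h3 := ncard_full_le (G := G) hr
  have h4 : (A.filter fun d => κ d = κ d₀).card =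
      {d : HyperfieldClass (r + 1) | Nonempty (WithZero G ≃* d.Rep) ∧
        Hyperfield.hadd (1 : d.Rep) 1 = Set.univ}.ncard := by
    rw [← Set.ncard_coe_finset]
    congr 1
    ext d
    simp [A, hiff, and_comm]
  have h5 : (Finset.univ.filter fun d => κ d = κ d₀).card =
      {d : HyperfieldClass (r + 1) | Nonempty (WithZero G ≃* d.Rep)}.ncard := by
    rw [← Set.ncard_coe_finset]
    congr 1
    ext d
    simp [hiff]
  rw [h4, h5]
  exact ((Nat.mul_le_mul_right _ h3).trans h2).trans h1

/-- There are few quotients of small finite fields. -/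
theorem ncard_smallFieldQuotient_le (r : ℕ) :
    {d : HyperfieldClass (r + 1) | ∃ (F : Type u) (_ : Field F) (_ : Finite F) (G : Subgroup Fˣ),
        Nat.card F ≤ 16 * r ^ 4 ∧ G.index = r ∧ HyperfieldIso d.Rep (FieldQuotient G)}.ncard ≤
      16 * r ^ 4 + 1 := by
  classical
  rw [← Finset.card_range (16 * r ^ 4 + 1), ← Set.ncard_coe_finset]
  -- With the index fixed at `r`, the size of the field determines the class; the default `0` is
  -- never used.
  refine Set.ncard_le_ncard_of_injOn (fun d => if h : ∃ (F : Type u) (_ : Field F) (_ : Finite F)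
    (G : Subgroup Fˣ), Nat.card F ≤ 16 * r ^ 4 ∧ G.index = r ∧
      HyperfieldIso d.Rep (FieldQuotient G) then Nat.card h.choose else 0) ?_ ?_ (Set.toFinite _)
  · intro d h
    rw [Set.mem_ofPred_eq] at h
    rw [dif_pos h]
    obtain ⟨_, _, _, h1, -⟩ := h.choose_spec
    exact Finset.mem_coe.2 (Finset.mem_range.2 (by omega))
  · intro d h d' h' hdd
    rw [Set.mem_ofPred_eq] at h h'
    dsimp only at hdd
    rw [dif_pos h, dif_pos h'] at hdd
    obtain ⟨_, _, G, -, h1, h2⟩ := h.choose_spec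
    obtain ⟨_, _, G', -, h1', h2'⟩ := h'.choose_spec
    exact HyperfieldClass.eq_of_iso
      ((h2.trans (hyperfieldIso_of_natCard_eq hdd (h1.trans h1'.symm))).trans h2'.symm)

theorem numHyperfields_pos (r : ℕ) (hr : 0 < r) : 0 < numHyperfields r := by
  obtain ⟨G, _, hG⟩ := exists_commGroup_natCard_eq hr
  have : Finite G := Nat.finite_of_card_ne_zero (by omega)
  have hT : IsRichRelation (fun _ _ _ : G => True) :=
    ⟨fun _ _ _ h => h, fun _ _ _ h => h, fun _ _ _ _ h => h, fun _ _ _ _ => ⟨1, trivial, trivial⟩⟩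
  have : Nonempty (HyperfieldClass (r + 1)) := ⟨⟦hT.hyperfieldOfOrder hG⟧⟩
  exact Nat.card_pos

theorem numQuotientHyperfields_mul_le {r : ℕ} (hr : Odd r)
    (h : 2 * r ^ 4 * 3 ^ (r / 12) ≤ 4 ^ (r / 12)) :
    numQuotientHyperfields.{u} r * 2 ^ (r / 3) ≤
      (16 * r ^ 4 + 2) * (2 * (r + 1) ^ Nat.log 2 r) * numHyperfields r := by
  have hsub : quotientClasses.{u} (r + 1) ⊆
      {d : HyperfieldClass (r + 1) | Hyperfield.hadd (1 : d.Rep) 1 = Set.univ} ∪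
      {d : HyperfieldClass (r + 1) | ∃ (F : Type u) (_ : Field F) (_ : Finite F) (G : Subgroup Fˣ),
        Nat.card F ≤ 16 * r ^ 4 ∧ G.index = r ∧ HyperfieldIso d.Rep (FieldQuotient G)} := by
    rintro _ ⟨X, ⟨F, _, G, hX⟩, rfl⟩
    refine IsQuotientHyperfield.hadd_one_one_eq_univ_or hr (HyperfieldOfOrder.card_eq _) ?_
    exact ⟨F, _, G, X.iso_rep.symm.trans hX⟩
  have h1 := (Set.ncard_le_ncard hsub (Set.toFinite _)).trans (Set.ncard_union_le _ _)
  have h2 := ncard_hadd_one_one_eq_univ_mul_le hr h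
  have h3 := ncard_smallFieldQuotient_le.{u} r
  have h4 := two_pow_le_natCard_hyperfieldClass hr.pos h
  calc numQuotientHyperfields.{u} r * 2 ^ (r / 3)
      ≤ (_ + (16 * r ^ 4 + 1)) * 2 ^ (r / 3) :=
        Nat.mul_le_mul_right _ (h1.trans (Nat.add_le_add_left h3 _))
    _ ≤ 2 * (r + 1) ^ Nat.log 2 r * numHyperfields r +
        (16 * r ^ 4 + 1) * (2 * (r + 1) ^ Nat.log 2 r * numHyperfields r) := by
      rw [add_mul]
      exact Nat.add_le_add h2 (Nat.mul_le_mul_left _ h4)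
    _ = _ := by ring

end Ratio

/-! ### Asymptotics -/

section Limit

theorem eventually_pow_four_mul_three_pow_le :
    ∀ᶠ r : ℕ in atTop, 2 * r ^ 4 * 3 ^ (r / 12) ≤ 4 ^ (r / 12) := by
  have h1 : Tendsto (fun m : ℕ => 2 * 23 ^ 4 * ((m : ℝ) ^ 4 * (3 / 4 : ℝ) ^ m)) atTop (𝓝 0) := by
    have := (tendsto_pow_const_mul_const_pow_of_abs_lt_one 4
      (r := (3 / 4 : ℝ)) (by norm_num [abs_of_pos])).const_mul (2 * 23 ^ 4)
    simpa using this
  have h2 : ∀ᶠ m : ℕ in atTop, 1 ≤ m ∧ 2 * (23 * m) ^ 4 * 3 ^ m ≤ 4 ^ m := by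
    filter_upwards [h1.eventually_le_const zero_lt_one, eventually_ge_atTop 1] with m hm hm1
    refine ⟨hm1, ?_⟩
    have h4 : (0 : ℝ) < 4 ^ m := by positivity
    rw [div_pow, ← mul_div_assoc, ← mul_div_assoc, div_le_one h4] at hm
    have : (2 * (23 * m) ^ 4 * 3 ^ m : ℝ) ≤ 4 ^ m := by
      refine le_trans (le_of_eq ?_) hm
      ring
    exact_mod_cast this
  filter_upwards [(Nat.tendsto_div_const_atTop (by norm_num : 12 ≠ 0)).eventually h2] with r hr
  obtain ⟨hr1, hr2⟩ := hr
  refine le_trans ?_ hr2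
  -- The worst case with `r / 12 ≥ 1` is `r = 23`.
  have : r ≤ 23 * (r / 12) := by omega
  gcongr

theorem six_mul_le_two_pow {L : ℕ} (hL : 11 ≤ L) : 6 * (L ^ 2 + 5 * L + 10) ≤ 2 ^ L := by
  induction L, hL using Nat.le_induction with
  | base => norm_num
  | succ n hn ih =>
    rw [pow_succ 2 n]
    nlinarith

/-- With `L = log₂ r` the left side is at most `2 ^ (L ^ 2 + 6 * L + 10)`, a quadratic exponent in
`L`, while `r / 3` grows like `2 ^ L`. The extra factor `2 ^ L` is what remains as the rate of decay
of the ratio. -/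
theorem bound_mul_two_pow_log_le {r : ℕ} (hr : 2 ^ 11 ≤ r) :
    (16 * r ^ 4 + 2) * (2 * (r + 1) ^ Nat.log 2 r) * 2 ^ Nat.log 2 r ≤ 2 ^ (r / 3) := by
  set L := Nat.log 2 r with hLdef
  have hL : 11 ≤ L := Nat.le_log_of_pow_le (by norm_num) hr
  have h1 : r + 1 ≤ 2 ^ (L + 1) := Nat.lt_pow_succ_log_self (by norm_num) r
  have h2 : 2 ^ L ≤ r := Nat.pow_log_le_self 2 (by omega)
  have h3 := six_mul_le_two_pow hL
  have h4 : 16 * r ^ 4 + 2 ≤ 2 ^ 5 * (2 ^ (L + 1)) ^ 4 := by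
    have : r ^ 4 ≤ (2 ^ (L + 1)) ^ 4 := Nat.pow_le_pow_left (by omega) 4
    have : 1 ≤ r ^ 4 := Nat.one_le_pow _ _ (by omega)
    omega
  calc (16 * r ^ 4 + 2) * (2 * (r + 1) ^ L) * 2 ^ L
      ≤ (2 ^ 5 * (2 ^ (L + 1)) ^ 4) * (2 * (2 ^ (L + 1)) ^ L) * 2 ^ L := by gcongr
    _ = 2 ^ (L ^ 2 + 6 * L + 10) := by ring
    _ ≤ 2 ^ (r / 3) := Nat.pow_le_pow_right (by norm_num) (by
      have : L ^ 2 + 6 * L + 10 ≤ 2 * (L ^ 2 + 5 * L + 10) := by nlinarith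
      omega)

theorem ratio_le {r : ℕ} (hr : Odd r) (hr' : 2 ^ 11 ≤ r)
    (h : 2 * r ^ 4 * 3 ^ (r / 12) ≤ 4 ^ (r / 12)) :
    (numQuotientHyperfields.{u} r : ℝ) / (numHyperfields r : ℝ) ≤ (1 / 2 : ℝ) ^ Nat.log 2 r := by
  have hpos := numHyperfields_pos r hr.pos
  have h1 := numQuotientHyperfields_mul_le.{u} hr h
  have h2 := bound_mul_two_pow_log_le hr'
  have h3 : numQuotientHyperfields.{u} r * 2 ^ Nat.log 2 r ≤ numHyperfields r := by
    set B := (16 * r ^ 4 + 2) * (2 * (r + 1) ^ Nat.log 2 r) with hB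
    have hB0 : 0 < B := by positivity
    refine Nat.le_of_mul_le_mul_left ?_ hB0
    calc B * (numQuotientHyperfields.{u} r * 2 ^ Nat.log 2 r)
        = numQuotientHyperfields.{u} r * (B * 2 ^ Nat.log 2 r) := by ring
      _ ≤ _ := (Nat.mul_le_mul_left _ h2).trans h1
  rw [div_pow, one_pow, div_le_div_iff₀ (by exact_mod_cast hpos) (by positivity), one_mul]
  exact_mod_cast h3

end Limit

theorem mainTheorem2 :
    (∀ r : ℕ, Odd r → Finite (HyperfieldClass (r + 1)) ∧ 0 < numHyperfields r) ∧
    Tendsto (fun r : ℕ => (numQuotientHyperfields.{u} r : ℝ) / (numHyperfields r : ℝ))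
      (atTop ⊓ 𝓟 {r : ℕ | Odd r}) (𝓝 0) := by
  refine ⟨fun r hr => ⟨inferInstance, numHyperfields_pos r hr.pos⟩, ?_⟩
  have hlog : Tendsto (fun r : ℕ => Nat.log 2 r) atTop atTop := by
    refine tendsto_atTop.2 fun b => ?_
    filter_upwards [eventually_ge_atTop (2 ^ b)] with r hr
    exact Nat.le_log_of_pow_le (by norm_num) hr
  have hlim : Tendsto (fun r : ℕ => (1 / 2 : ℝ) ^ Nat.log 2 r) (atTop ⊓ 𝓟 {r : ℕ | Odd r}) (𝓝 0) :=
    ((tendsto_pow_atTop_nhds_zero_of_lt_one (by norm_num) (by norm_num)).comp hlog).mono_left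
      inf_le_left
  refine squeeze_zero' (Eventually.of_forall fun r => by positivity) ?_ hlim
  filter_upwards [mem_inf_of_left (eventually_ge_atTop (2 ^ 11)),
    mem_inf_of_left eventually_pow_four_mul_three_pow_le,
    mem_inf_of_right (mem_principal_self _)] with r h1 h2 h3
  exact ratio_le h3 h1 h2
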